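/- **2-complexes.** A 2-complex $Y=(V,E,F)$ consists of vertices, oriented edges and oriented faces. Each edge $e$ has a start, an end and an inverse edge $e^{-1}\neq e$; each face $f$ has an inverse face $f^{-1}$ and a boundary $\partial f$, which is a nonempty cyclically reduced edge loop with a starting point, and $\partial(f^{-1})=(\partial f)^{-1}$. Geometric edges (faces) are pairs of inverse edges (faces); $|Y|$ is the number of geometric faces and $\mathrm{Edge}(Y)$ the set of geometric edges. A sub-2-complex $Z\le Y$ is a set of vertices, edges and faces closed under endpoints, inverses and boundaries. **Fillability.** Let $X_m=\{x_1,\dots,x_m\}$ and let $R$ be a set of words in $X_m^{\pm}$. A van Kampen 2-complex of $\langle X_m\mid R\rangle$ with underlying 2-complex $Y$ is a labeling of the edges by $X_m^{\pm}$ and of the faces by $R^{\pm}$, compatible with inverses, such that the label of each face is the word read along its boundary. It is reduced if there are no two different faces $f,f'\in F$ with the same label and with a common edge at the same position of $\partial f$ and $\partial f'$. The 2-complex $Y$ is fillable by $R$ (or by the group presentation $\langle X_m\mid R\rangle$) if it underlies a reduced van Kampen 2-complex of $\langle X_m\mid R\rangle$. **Random groups.** Let $B_\ell$ be the set of cyclically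 reduced words in $X_m^{\pm}$ of length at most $\ell$. A sequence of random groups $(G_\ell(m,d))$ with $m$ generators at density $d\in\{-\infty\}\cup[0,1]$ is given by $G_\ell(m,d)=\langle X_m\mid R_\ell\rangle$, where $R_\ell$ is a random subset of $B_\ell$ whose law is invariant under all permutations of $B_\ell$, and $\log_{|B_\ell|}|R_\ell|$ (with value $-\infty$ when $R_\ell=\emptyset$) converges in probability to $d$ as $\ell\to\infty$. A property of $G_\ell(m,d)$ holds a.a.s. if its probability tends to $1$ as $\ell\to\infty$. **Geometric forms.** A geometric form $(Y,\lambda)$ is a finite connected 2-complex $Y$ with at least one face, in which every edge lies on the boundary of a face, together with lengths $\lambda_e\in(0,1]$ for $e\in\mathrm{Edge}(Y)$ such that every face boundary has total length at most $1$. For $\ell$ large enough that all $\lfloor\lambda_e\ell\rfloor\ge1$, $Y_\ell$ is the 2-complex obtained from $Y$ by dividing every edge $e$ into $\lfloor\lambda_e\ell\rfloor$ edges. For $Z\le Y$ with $|Z|\ge1$ put $$\mathrm{dens}(Z)=\frac{1}{|Z|}\sum_{e\in \mathrm{Edge}(Z)}\lambda_e,\qquad \mathrm{dens}_c(Y)=\min_{Z\le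 Y,\ |Z|\ge 1}\mathrm{dens}(Z).$$ **Theorem.** Let $m\ge2$, let $(G_\ell(m,d))$ be a sequence of random groups with $m$ generators at density $d$, and let $(Y_\ell)$ be the sequence of 2-complexes of a geometric form $(Y,\lambda)$. (i) If $d<1-\mathrm{dens}_c(Y)$, then a.a.s. $Y_\ell$ is not fillable by $G_\ell(m,d)$. (ii) If $d>1-\mathrm{dens}_c(Y)$ and $Y_\ell$ is fillable by $B_\ell$ for all sufficiently large $\ell$, then a.a.s. $Y_\ell$ is fillable by $G_\ell(m,d)$. -/

import Mathlib

open Filter Topology MeasureTheory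

/-! ### Oriented combinatorial 2-complexes -/

/-- An oriented combinatorial 2-complex with vertices `V`, oriented edges `E` and oriented
faces `F`. Edges and faces come with an inverse; the boundary of a face is a nonempty
cyclically reduced loop of edges (a list, so that it has a starting point and a `j`-th edge).
A geometric edge (face) is a pair of inverse edges (faces). -/
structure TwoComplex (V E F : Type*) where
  src : E → V
  tgt : E → V
  inv : E → E
  inv_inv : ∀ e, inv (inv e) = e
  inv_ne : ∀ e, inv e ≠ e
  src_inv : ∀ e, src (inv e) = tgt e
  tgt_inv : ∀ e, tgt (inv e) = src e
  finv : F → F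
  finv_finv : ∀ f, finv (finv f) = f
  bdry : F → List E
  bdry_ne_nil : ∀ f, bdry f ≠ []
  /-- For any two cyclically consecutive edges `a`, `b` of the boundary, `b` starts where `a`
  ends, and `b` is not the inverse of `a`. -/
  bdry_chain : ∀ f, Cycle.Chain (fun a b => tgt a = src b ∧ b ≠ inv a) (bdry f : Cycle E)
  bdry_finv : ∀ f, bdry (finv f) = ((bdry f).map inv).reverse

namespace TwoComplex

variable {V E F : Type*}

/-- Any two vertices are joined by an edge path, and there is a vertex. -/
def Connected (Y : TwoComplex V E F) : Prop :=
  Nonempty V ∧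
    ∀ u v : V, Relation.ReflTransGen (fun a b => ∃ e, Y.src e = a ∧ Y.tgt e = b) u v

/-- Every edge is on the boundary of some face. -/
def NoIsolatedEdges (Y : TwoComplex V E F) : Prop :=
  ∀ e, ∃ f, e ∈ Y.bdry f

/-- A sub-2-complex: sets of vertices, edges, faces closed under endpoints, inverses and
boundaries. -/
@[ext]
structure Sub (Y : TwoComplex V E F) where
  verts : Set V
  edges : Set E
  faces : Set F
  src_mem : ∀ e ∈ edges, Y.src e ∈ verts
  tgt_mem : ∀ e ∈ edges, Y.tgt e ∈ verts
  inv_mem : ∀ e ∈ edges, Y.inv e ∈ edges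
  finv_mem : ∀ f ∈ faces, Y.finv f ∈ faces
  bdry_mem : ∀ f ∈ faces, ∀ e ∈ Y.bdry f, e ∈ edges

/-- The 2-complex itself, as a sub-2-complex. -/
def Sub.top (Y : TwoComplex V E F) : Y.Sub where
  verts := Set.univ
  edges := Set.univ
  faces := Set.univ
  src_mem := fun _ _ => Set.mem_univ _
  tgt_mem := fun _ _ => Set.mem_univ _
  inv_mem := fun _ _ => Set.mem_univ _
  finv_mem := fun _ _ => Set.mem_univ _
  bdry_mem := fun _ _ _ _ => Set.mem_univ _

theorem finv_ne (Y : TwoComplex V E F) (f : F) : Y.finv f ≠ f := by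
  intro h
  have hb := Y.bdry_finv f
  have hc := Y.bdry_chain f
  have hn := Y.bdry_ne_nil f
  rw [h] at hb
  cases hl : Y.bdry f with
  | nil => exact hn hl
  | cons a l =>
    rw [hl] at hb hc
    rw [Cycle.chain_coe_cons] at hc
    rcases List.eq_nil_or_concat l with rfl | ⟨l', b, rfl⟩
    · simp at hb
      exact Y.inv_ne a hb.symm
    · simp at hb
      have h2 : List.IsChain (fun a b => Y.tgt a = Y.src b ∧ b ≠ Y.inv a)
          ((a :: l') ++ [b, a]) := by simpa using hc
      have h3 := h2.right_of_append
      simp only [List.isChain_cons_cons] at h3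
      exact h3.1.2 hb.1

/-! ### Subdivision -/

/-- The point at distance `i` from the start on the arc of `n e` unit edges replacing `e`.
An interior point is the unordered pair of its two descriptions, along `e` and along the
inverse edge. -/
def point (Y : TwoComplex V E F) (n : E → ℕ) (e : E) (i : ℕ) : V ⊕ Sym2 (E × ℕ) :=
  if i = 0 then Sum.inl (Y.src e)
  else if i = n e then Sum.inl (Y.tgt e)
  else Sum.inr s((e, i), (Y.inv e, n e - i))

/-- Vertices of the subdivision: the vertices of `Y` and the interior points of the arcs. -/
def SubdivVert (Y : TwoComplex V E F) (n : E → ℕ) : Type _ :=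
  {x : V ⊕ Sym2 (E × ℕ) // (∃ v, x = Sum.inl v) ∨ ∃ e i, i ≤ n e ∧ x = Y.point n e i}

/-- Oriented edges of the subdivision: `(e, i)` with `i < n e` is the unit edge from the `i`-th
to the `(i+1)`-st point of the arc of `e`. -/
abbrev SubdivEdge (n : E → ℕ) : Type _ := {p : E × ℕ // p.2 < n p.1}

/-- The arc of unit edges replacing `e`. -/
def arc (n : E → ℕ) (e : E) : List (SubdivEdge n) :=
  (List.finRange (n e)).map fun i : Fin (n e) => ⟨(e, i.1), i.2⟩

theorem arc_length (n : E → ℕ) (e : E) : (arc n e).length = n e := by simp [arc]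

theorem arc_getElem? (n : E → ℕ) (e : E) (i : ℕ) (hi : i < n e) :
    (arc n e)[i]? = some ⟨(e, i), hi⟩ := by
  rw [List.getElem?_eq_getElem (by rw [arc_length]; exact hi)]
  simp [arc]

theorem point_inv (Y : TwoComplex V E F) {n : E → ℕ} (hinv : ∀ e, n (Y.inv e) = n e)
    (hn : ∀ e, 0 < n e) (e : E) (i : ℕ) (hi : i ≤ n e) :
    Y.point n (Y.inv e) (n e - i) = Y.point n e i := by
  have := hn e
  unfold point
  rw [hinv, Y.src_inv, Y.tgt_inv, Y.inv_inv]
  by_cases h0 : i = 0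
  · subst h0
    rw [if_neg (by omega), if_pos (by omega), if_pos rfl]
  · by_cases h1 : i = n e
    · rw [if_pos (by omega), if_neg h0, if_pos h1]
    · rw [if_neg (by omega), if_neg (by omega), if_neg h0, if_neg h1]
      have h2 : n e - (n e - i) = i := by omega
      rw [h2, Sym2.eq_swap]

/-- The inverse of the `i`-th unit edge of `e` is the `(n e - 1 - i)`-th unit edge of the
inverse of `e`. -/
def subdivInv (Y : TwoComplex V E F) {n : E → ℕ} (hinv : ∀ e, n (Y.inv e) = n e)
    (p : SubdivEdge n) : SubdivEdge n :=
  ⟨(Y.inv p.1.1, n p.1.1 - 1 - p.1.2), by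
    have := p.2
    rw [hinv]
    show n p.1.1 - 1 - p.1.2 < n p.1.1
    omega⟩

/-- Starting point of a unit edge. -/
def subdivSrc (Y : TwoComplex V E F) (n : E → ℕ) (p : SubdivEdge n) : SubdivVert Y n :=
  ⟨Y.point n p.1.1 p.1.2, Or.inr ⟨_, _, p.2.le, rfl⟩⟩

/-- Ending point of a unit edge. -/
def subdivTgt (Y : TwoComplex V E F) (n : E → ℕ) (p : SubdivEdge n) : SubdivVert Y n :=
  ⟨Y.point n p.1.1 (p.1.2 + 1), Or.inr ⟨_, _, p.2, rfl⟩⟩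

theorem subdiv_isChain (Y : TwoComplex V E F) {n : E → ℕ}
    (hinv : ∀ e, n (Y.inv e) = n e) (hn : ∀ e, 0 < n e) (l : List E)
    (hl : List.IsChain (fun a b => Y.tgt a = Y.src b ∧ b ≠ Y.inv a) l) :
    List.IsChain (fun p q => Y.subdivTgt n p = Y.subdivSrc n q ∧ q ≠ Y.subdivInv hinv p)
      (l.flatMap (arc n)) := by
  have harc : ∀ e, List.IsChain
      (fun p q => Y.subdivTgt n p = Y.subdivSrc n q ∧ q ≠ Y.subdivInv hinv p) (arc n e) := by
    intro e
    rw [List.isChain_iff_getElem]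
    intro i hi
    refine ⟨?_, ?_⟩
    · apply Subtype.ext
      simp [arc, subdivTgt, subdivSrc]
    · intro h
      have h1 := congrArg (fun p => p.1.1) h
      simp [arc, subdivInv] at h1
      exact Y.inv_ne e h1.symm
  induction l with
  | nil => simp
  | cons a l ih =>
    rw [List.flatMap_cons, List.isChain_append]
    refine ⟨harc a, ih hl.tail, ?_⟩
    intro p hp q hq
    cases l with
    | nil => simp at hq
    | cons b l =>
      have hab : Y.tgt a = Y.src b ∧ b ≠ Y.inv a := by
        rw [List.isChain_cons_cons] at hl
        exact hl.1
      have ha := hn a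
      have hb := hn b
      have hp' : p = ⟨(a, n a - 1), by show n a - 1 < n a; omega⟩ := by
        rw [List.getLast?_eq_getElem?, arc_length, arc_getElem? n a (n a - 1) (by omega)] at hp
        exact (Option.some.inj hp).symm
      have hq' : q = ⟨(b, 0), hb⟩ := by
        rw [List.head?_eq_getElem?, List.flatMap_cons,
          List.getElem?_append_left (by rw [arc_length]; exact hb), arc_getElem? n b 0 hb] at hq
        exact (Option.some.inj hq).symm
      rw [hp', hq']
      refine ⟨?_, ?_⟩
      · apply Subtype.ext
        show Y.point n a (n a - 1 + 1) = Y.point n b 0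
        have h1 : n a - 1 + 1 = n a := by omega
        rw [h1]
        simp [point, ha.ne', hab.1]
      · intro h
        exact hab.2 (congrArg (fun p => p.1.1) h)

theorem arc_inv (Y : TwoComplex V E F) {n : E → ℕ} (hinv : ∀ e, n (Y.inv e) = n e) (e : E) :
    arc n (Y.inv e) = ((arc n e).map (Y.subdivInv hinv)).reverse := by
  apply List.ext_getElem
  · simp [arc, hinv]
  · intro i h1 h2
    have h3 : i < n e := by simpa [arc, hinv] using h1
    simp only [arc, List.getElem_map, List.getElem_reverse, subdivInv]
    apply Subtype.ext
    simp
    omega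

/-- The 2-complex obtained from `Y` by dividing every edge `e` into `n e` edges. -/
def subdivide (Y : TwoComplex V E F) (n : E → ℕ) (hinv : ∀ e, n (Y.inv e) = n e)
    (hn : ∀ e, 0 < n e) : TwoComplex (SubdivVert Y n) (SubdivEdge n) F where
  src := Y.subdivSrc n
  tgt := Y.subdivTgt n
  inv := Y.subdivInv hinv
  inv_inv := by
    rintro ⟨⟨e, i⟩, hi⟩
    apply Subtype.ext
    have hi' : i < n e := hi
    show (Y.inv (Y.inv e), n (Y.inv e) - 1 - (n e - 1 - i)) = (e, i)
    rw [Y.inv_inv, hinv]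
    congr 1
    omega
  inv_ne := fun p h => Y.inv_ne p.1.1 (congrArg (fun p => p.1.1) h)
  src_inv := by
    rintro ⟨⟨e, i⟩, hi⟩
    have hi' : i < n e := hi
    apply Subtype.ext
    show Y.point n (Y.inv e) (n e - 1 - i) = Y.point n e (i + 1)
    rw [← Y.point_inv hinv hn e (i + 1) hi']
    congr 1
    omega
  tgt_inv := by
    rintro ⟨⟨e, i⟩, hi⟩
    have hi' : i < n e := hi
    apply Subtype.ext
    show Y.point n (Y.inv e) (n e - 1 - i + 1) = Y.point n e i
    rw [← Y.point_inv hinv hn e i hi'.le]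
    congr 1
    omega
  finv := Y.finv
  finv_finv := Y.finv_finv
  bdry := fun f => (Y.bdry f).flatMap (arc n)
  bdry_ne_nil := by
    intro f h
    rw [List.flatMap_eq_nil_iff] at h
    obtain ⟨a, ha⟩ := List.exists_mem_of_ne_nil _ (Y.bdry_ne_nil f)
    have h1 := congrArg List.length (h a ha)
    have h2 := hn a
    simp [arc] at h1
    omega
  bdry_chain := by
    intro f
    have hc := Y.bdry_chain f
    have hne := Y.bdry_ne_nil f
    cases hl : Y.bdry f with
    | nil => exact absurd hl hne
    | cons a l =>
      rw [hl, Cycle.chain_coe_cons] at hc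
      have h1 := Y.subdiv_isChain hinv hn _ hc
      have ha : ∃ t, arc n a = ⟨(a, 0), hn a⟩ :: t := by
        cases ht : arc n a with
        | nil =>
          have h2 := congrArg List.length ht
          have h3 := hn a
          simp [arc] at h2
          omega
        | cons x t =>
          refine ⟨t, ?_⟩
          have h2 : (arc n a)[0]? = some x := by rw [ht]; rfl
          rw [arc_getElem? n a 0 (hn a)] at h2
          rw [Option.some.inj h2]
      obtain ⟨t, ht⟩ := ha
      rw [List.flatMap_cons, ht, List.cons_append, Cycle.chain_coe_cons]
      rw [List.flatMap_cons, List.flatMap_append, List.flatMap_singleton, ht] at h1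
      have h4 : (((⟨(a, 0), hn a⟩ : SubdivEdge n) :: t) ++
          (l.flatMap (arc n) ++ ⟨(a, 0), hn a⟩ :: t)) =
          ((⟨(a, 0), hn a⟩ : SubdivEdge n) :: (t ++ l.flatMap (arc n) ++ [⟨(a, 0), hn a⟩])) ++ t := by
        simp
      rw [h4] at h1
      exact h1.left_of_append
  bdry_finv := by
    intro f
    rw [Y.bdry_finv]
    induction Y.bdry f with
    | nil => rfl
    | cons a l ih =>
      rw [List.map_cons, List.reverse_cons, List.flatMap_append, ih, List.flatMap_singleton,
        Y.arc_inv hinv, List.flatMap_cons, List.map_append, List.reverse_append]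

end TwoComplex

/-! ### Words, van Kampen 2-complexes, fillability -/

/-- Words in the letters `x₁^±, …, x_m^±`; the letter `(i, true)` is `x_i` and `(i, false)` is
its inverse. The inverse of a word `w` is `FreeGroup.invRev w`. -/
abbrev RelWord (m : ℕ) : Type := List (Fin m × Bool)

/-- The set `B_ℓ` of cyclically reduced words of length at most `ℓ`. -/
def relBall (m ℓ : ℕ) : Set (RelWord m) :=
  {w | FreeGroup.IsCyclicallyReduced w ∧ w.length ≤ ℓ}

theorem relBall_finite (m ℓ : ℕ) : (relBall m ℓ).Finite :=
  (List.finite_length_le (Fin m × Bool) ℓ).subset fun _ hw => hw.2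

/-- Labels turning the 2-complex `Y` into a van Kampen 2-complex with respect to `⟨x₁, …, x_m | R⟩`:
edges are labeled by generators and their inverses, faces by relators in `R` and their inverses,
and the label of a face is read along its boundary. -/
structure VanKampenLabeling {V E F : Type*} (Y : TwoComplex V E F) {m : ℕ}
    (R : Set (RelWord m)) where
  edgeLabel : E → Fin m × Bool
  faceLabel : F → RelWord m
  edgeLabel_inv : ∀ e, edgeLabel (Y.inv e) = ((edgeLabel e).1, !(edgeLabel e).2)
  faceLabel_mem : ∀ f, faceLabel f ∈ R ∨ FreeGroup.invRev (faceLabel f) ∈ R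
  faceLabel_finv : ∀ f, faceLabel (Y.finv f) = FreeGroup.invRev (faceLabel f)
  map_bdry : ∀ f, (Y.bdry f).map edgeLabel = faceLabel f

/-- Two different faces are a reducible pair if they have the same label and a common boundary
edge at the same position; the van Kampen 2-complex is reduced if there is no such pair. -/
def VanKampenLabeling.IsReduced {V E F : Type*} {Y : TwoComplex V E F} {m : ℕ}
    {R : Set (RelWord m)} (φ : VanKampenLabeling Y R) : Prop :=
  ∀ f g : F, f ≠ g → φ.faceLabel f = φ.faceLabel g →
    ¬ ∃ (j : ℕ) (e : E), (Y.bdry f)[j]? = some e ∧ (Y.bdry g)[j]? = some e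

/-- `Y` is fillable by `R` if it underlies a reduced van Kampen 2-complex of `⟨x₁, …, x_m | R⟩`. -/
def Fillable {V E F : Type*} (Y : TwoComplex V E F) {m : ℕ} (R : Set (RelWord m)) : Prop :=
  ∃ φ : VanKampenLabeling Y R, φ.IsReduced

/-! ### Geometric forms -/

/-- A geometric form: a finite connected 2-complex without isolated edges, with at least one
face, and a length in `(0, 1]` for every geometric edge (that is, a function on oriented edges
invariant under inversion) such that all face boundaries have length at most `1`. -/
structure GeometricForm (V E F : Type*) extends TwoComplex V E F where
  finite_verts : Finite V
  finite_edges : Finite E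
  finite_faces : Finite F
  nonempty_faces : Nonempty F
  connected : toTwoComplex.Connected
  noIsolatedEdges : toTwoComplex.NoIsolatedEdges
  len : E → ℝ
  len_inv : ∀ e, len (inv e) = len e
  len_pos : ∀ e, 0 < len e
  len_le_one : ∀ e, len e ≤ 1
  bdry_len_le : ∀ f, ((bdry f).map len).sum ≤ 1

namespace GeometricForm

variable {V E F : Type*}

/-- The density of a sub-2-complex: total length of its geometric edges divided by its number of
geometric faces. Every geometric edge consists of two different oriented edges of the same
length, and every geometric face of two different oriented faces, hence the two halves. -/
noncomputable def dens (G : GeometricForm V E F) (Z : G.toTwoComplex.Sub) : ℝ :=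
  ((∑ᶠ e ∈ Z.edges, G.len e) / 2) / ((Z.faces.ncard : ℝ) / 2)

/-- The critical density: the minimum of the densities of the sub-2-complexes having a face
(it is attained, see `exists_dens_eq_densC`). -/
noncomputable def densC (G : GeometricForm V E F) : ℝ :=
  ⨅ Z : {Z : G.toTwoComplex.Sub // Z.faces.Nonempty}, G.dens Z.1

theorem finite_sub (G : GeometricForm V E F) : Finite G.toTwoComplex.Sub := by
  have := G.finite_verts
  have := G.finite_edges
  have := G.finite_faces
  refine Finite.of_injective
    (fun Z : G.toTwoComplex.Sub => (Z.verts, Z.edges, Z.faces)) ?_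
  intro Z W h
  simp only [Prod.mk.injEq] at h
  exact TwoComplex.Sub.ext h.1 h.2.1 h.2.2

theorem exists_dens_eq_densC (G : GeometricForm V E F) :
    ∃ Z : G.toTwoComplex.Sub, Z.faces.Nonempty ∧ G.dens Z = G.densC := by
  have := G.finite_sub
  have : Nonempty {Z : G.toTwoComplex.Sub // Z.faces.Nonempty} :=
    ⟨⟨TwoComplex.Sub.top _, G.nonempty_faces.elim fun f => ⟨f, Set.mem_univ f⟩⟩⟩
  obtain ⟨Z, hZ⟩ := exists_eq_ciInf_of_finite
    (f := fun Z : {Z : G.toTwoComplex.Sub // Z.faces.Nonempty} => G.dens Z.1)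
  exact ⟨Z.1, Z.2, hZ⟩

theorem densC_le (G : GeometricForm V E F) (Z : G.toTwoComplex.Sub) (hZ : Z.faces.Nonempty) :
    G.densC ≤ G.dens Z := by
  have := G.finite_sub
  exact ciInf_le (Set.finite_range _).bddBelow
    (⟨Z, hZ⟩ : {Z : G.toTwoComplex.Sub // Z.faces.Nonempty})

/-- The number of unit edges into which the edge `e` is divided: `⌊len e * ℓ⌋`. This is positive
for all large `ℓ`; the value `1` in place of `0` only occurs for the finitely many small `ℓ` for
which some edge would be divided into no edge at all. -/
noncomputable def numEdges (G : GeometricForm V E F) (ℓ : ℕ) (e : E) : ℕ :=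
  max 1 ⌊G.len e * ℓ⌋₊

/-- The sequence `(Y_ℓ)` of 2-complexes of the given geometric form. -/
noncomputable def complex (G : GeometricForm V E F) (ℓ : ℕ) :
    TwoComplex (TwoComplex.SubdivVert G.toTwoComplex (G.numEdges ℓ))
      (TwoComplex.SubdivEdge (G.numEdges ℓ)) F :=
  G.toTwoComplex.subdivide (G.numEdges ℓ)
    (fun e => by simp only [numEdges, G.len_inv])
    (fun _ => lt_of_lt_of_le Nat.one_pos (le_max_left _ _))

end GeometricForm

/-! ### Random subsets with density -/

/-- The density `log_{|α|} |S|` of a subset `S` of a finite set `α`, with value `-∞` for the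
empty set. -/
noncomputable def setDens {α : Type*} (S : Set α) : EReal :=
  open Classical in
  if S = ∅ then ⊥ else ((Real.logb (Nat.card α) S.ncard : ℝ) : EReal)

/-- A sequence of random groups `G_ℓ(m, d) = ⟨x₁, …, x_m | R_ℓ⟩` at density `d`, given by its sets
of relators: `R_ℓ` is a random subset of `B_ℓ`, defined on a probability space `(Ω_ℓ, P_ℓ)`. -/
structure IsRandomGroupSeq {m : ℕ} {Ω : ℕ → Type*} [∀ ℓ, MeasurableSpace (Ω ℓ)]
    (P : ∀ ℓ, Measure (Ω ℓ)) (R : ∀ ℓ, Ω ℓ → Set (relBall m ℓ)) (d : EReal) : Prop where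
  /-- `R_ℓ` is a random variable with values in the finite set of subsets of `B_ℓ`. -/
  measurable : ∀ ℓ (S : Set (relBall m ℓ)), MeasurableSet {ω | R ℓ ω = S}
  /-- The law of `R_ℓ` is invariant under all permutations of `B_ℓ`. -/
  perm_invariant : ∀ ℓ (σ : Equiv.Perm (relBall m ℓ)) (S : Set (relBall m ℓ)),
    P ℓ {ω | R ℓ ω = σ '' S} = P ℓ {ω | R ℓ ω = S}
  /-- The density lies in `{-∞} ∪ [0, 1]`. -/
  density_mem : d = ⊥ ∨ (0 ≤ d ∧ d ≤ 1)
  /-- The random densities of the `R_ℓ` in `B_ℓ` converge in probability to `d`. -/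
  densable : ∀ U ∈ 𝓝 d, Tendsto (fun ℓ => P ℓ {ω | setDens (R ℓ ω) ∈ U}) atTop (𝓝 1)

/-- The relators of a random set `R ⊆ B_ℓ`, as a set of words. -/
def relators {m ℓ : ℕ} (R : Set (relBall m ℓ)) : Set (RelWord m) := Subtype.val '' R

/-- The events `Q_ℓ` hold asymptotically almost surely. -/
def AsymptoticallyAlmostSurely {Ω : ℕ → Type*} [∀ ℓ, MeasurableSpace (Ω ℓ)]
    (P : ∀ ℓ, Measure (Ω ℓ)) (Q : ∀ ℓ, Ω ℓ → Prop) : Prop :=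
  Tendsto (fun ℓ => P ℓ {ω | Q ℓ ω}) atTop (𝓝 1)

/-!
(i) Let `Z ≤ Y` attain `densC Y`. The type of a diagram records which faces of `Z` are labelled by
relators rather than by their inverses, and which of them carry the same label, the most frequent
labels coming first; there are boundedly many types. In a reduced diagram two faces with the same
label never meet an edge at the same position, so when the labels are read in this order every
geometric edge has at most one free letter, its other letters being determined by earlier ones.
Averaging over the initial segments of this order gives `k` distinct labels with at most `x * k`
free letters, where `x = ℓ * densC Y + const`. Hence at most `(2m(2m-1)^x)^k` tuples of `k` relators
can occur, and a union bound gives a probability of order `2m(2m-1)^x |B_ℓ|^(d-1)`, which tends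
to `0`.

(ii) Start from one filling by `B_ℓ`. Let the word on every oriented edge keep its first letter but
begin with a word of its own, so that the face labels stay cyclically reduced and distinct, and
fill the middle of the edge words freely. Two of these fillings sharing the labels of a set `J` of
faces agree on all edges on the boundary of `J`, hence on at least `(ℓ * densC Y - const) * |J|`
free letters. So by the second moment method the probability of no filling is of order
`|B_ℓ|^(1-d) (2m-1)^(-ℓ * densC Y)`, which tends to `0`.

Since the law of `R_ℓ` is invariant under permutations, both estimates reduce to uniformly random
subsets of `B_ℓ` of given size.
-/

/-! ### Uniform and exchangeable random subsets -/

section UniformSubsets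

open scoped BigOperators
open Finset (powersetCard)

theorem exists_perm_image_eq_of_card_eq {α : Type*} {S T : Finset α}
    (h : S.card = T.card) : ∃ σ : Equiv.Perm α, σ '' (S : Set α) = T := by
  classical
  have := Set.powersetCard.isPretransitive (α := α) (n := T.card)
  obtain ⟨σ, hσ⟩ := MulAction.exists_smul_eq (Equiv.Perm α)
    (⟨S, h⟩ : Set.powersetCard α T.card) ⟨T, rfl⟩
  have himage := congrArg (fun U : Set.powersetCard α T.card => ((U : Finset α) : Set α)) hσ
  simp only [Set.powersetCard.coe_smul, Finset.coe_smul_finset] at himage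
  exact ⟨σ, himage⟩

variable {α : Type*} [Fintype α] {n r : ℕ}

open Classical in
/-- The probability that a uniformly random `r`-element subset of `α` has the property `Q`. It is
`0` when `α` has no `r`-element subset. -/
noncomputable def subsetProb (r : ℕ) (Q : Finset α → Prop) : ℝ :=
  𝔼 S ∈ powersetCard r Finset.univ, if Q S then 1 else 0

theorem subsetProb_eq_expect (Q : Finset α → Prop) [DecidablePred Q] :
    subsetProb r Q = 𝔼 S ∈ powersetCard r Finset.univ, if Q S then 1 else 0 := by
  unfold subsetProb
  congr!

theorem subsetProb_nonneg (Q : Finset α → Prop) : 0 ≤ subsetProb r Q :=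
  Finset.expect_nonneg fun _ _ => by positivity

theorem subsetProb_mono {Q Q' : Finset α → Prop} (h : ∀ S, Q S → Q' S) :
    subsetProb r Q ≤ subsetProb r Q' := by
  unfold subsetProb
  gcongr with S
  split_ifs with h₁ h₂
  exacts [le_rfl, absurd (h S h₁) h₂, zero_le_one, le_rfl]

theorem subsetProb_exists_le_sum {ι : Type*} (s : Finset ι) (Q : ι → Finset α → Prop) :
    subsetProb r (fun S => ∃ i ∈ s, Q i S) ≤ ∑ i ∈ s, subsetProb r (Q i) := by
  classical
  unfold subsetProb
  rw [← Finset.expect_sum_comm]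
  gcongr with S
  have hnonneg : ∀ i ∈ s, (0 : ℝ) ≤ if Q i S then 1 else 0 := fun i _ => by positivity
  split_ifs with h
  · obtain ⟨i, hi, hQ⟩ := h
    exact (if_pos hQ).ge.trans (Finset.single_le_sum hnonneg hi)
  · exact Finset.sum_nonneg hnonneg

theorem sum_powersetCard_ite_eq_subsetProb_mul {p : Finset α → ℝ}
    (hp : ∀ S T : Finset α, S.card = T.card → p S = p T) (Q : Finset α → Prop) [DecidablePred Q] :
    ∑ S ∈ powersetCard r Finset.univ, (if Q S then p S else 0) =
      subsetProb r Q * ∑ S ∈ powersetCard r Finset.univ, p S := by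
  rcases (powersetCard r (Finset.univ : Finset α)).eq_empty_or_nonempty with hempty | ⟨T, hT⟩
  · simp [hempty]
  · have hconst : ∀ S ∈ powersetCard r Finset.univ, p S = p T := fun S hS =>
      hp S T ((Finset.mem_powersetCard.1 hS).2.trans (Finset.mem_powersetCard.1 hT).2.symm)
    calc _ = ∑ S ∈ powersetCard r Finset.univ, (if Q S then 1 else 0) * p T :=
          Finset.sum_congr rfl fun S hS => by rw [hconst S hS, ite_mul, one_mul, zero_mul]
      _ = subsetProb r Q * ((powersetCard r (Finset.univ : Finset α)).card * p T) := by
          rw [← Finset.sum_mul, ← Finset.card_mul_expect, ← subsetProb_eq_expect]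
          ring
      _ = _ := by rw [Finset.sum_congr rfl hconst, Finset.sum_const, nsmul_eq_mul]

variable {Ω : Type*} [MeasurableSpace Ω] {P : Measure Ω} {R : Ω → Set α}

theorem measureReal_eq_sum_ite [IsFiniteMeasure P] (hR : ∀ S, MeasurableSet {ω | R ω = S})
    (Q : Set α → Prop) [DecidablePred Q] :
    P.real {ω | Q (R ω)} = ∑ S : Finset α, if Q S then P.real {ω | R ω = S} else 0 := by
  have hunion : {ω | Q (R ω)} =
      ⋃ S ∈ Finset.univ.filter (fun S : Finset α => Q S), {ω | R ω = (S : Set α)} := by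
    ext ω
    simp only [Set.mem_ofPred_eq, Finset.mem_filter, Finset.mem_univ, true_and,
      Set.mem_iUnion, exists_prop]
    refine ⟨fun h => ?_, fun ⟨_, hS, h⟩ => h ▸ hS⟩
    obtain ⟨S, hS⟩ := (R ω).toFinite.exists_finset_coe
    exact ⟨S, hS ▸ h, hS.symm⟩
  have hdisj : Set.PairwiseDisjoint (Finset.univ.filter (fun S : Finset α => Q S) : Set (Finset α))
      fun S => {ω | R ω = (S : Set α)} := by
    refine fun S _ T _ hST => Set.disjoint_left.2 fun ω hS hT => hST ?_
    exact_mod_cast (show R ω = S from hS).symm.trans hT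
  rw [hunion, measureReal_biUnion_finset hdisj fun S _ => hR S, Finset.sum_filter]

theorem measureReal_le_of_subsetProb_le [IsProbabilityMeasure P]
    (hR : ∀ S, MeasurableSet {ω | R ω = S})
    (hperm : ∀ (σ : Equiv.Perm α) (S : Set α), P {ω | R ω = σ '' S} = P {ω | R ω = S})
    {C : ℕ → Prop} {Q : Set α → Prop} {ε : ℝ} (hε : 0 ≤ ε)
    (hQ : ∀ r ≤ Fintype.card α, C r → subsetProb r (fun S : Finset α => Q S) ≤ ε) :
    P.real {ω | C (R ω).ncard ∧ Q (R ω)} ≤ ε := by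
  classical
  let p : Finset α → ℝ := fun S => P.real {ω | R ω = S}
  have hp : ∀ S T : Finset α, S.card = T.card → p S = p T := by
    intro S T h
    obtain ⟨σ, hσ⟩ := exists_perm_image_eq_of_card_eq h
    simp only [p, measureReal_def, ← hσ, hperm]
  have hsum : ∀ f : Finset α → ℝ, ∑ S, f S =
      ∑ r ∈ Finset.range (Fintype.card α + 1), ∑ S ∈ powersetCard r Finset.univ, f S := by
    intro f
    rw [← Finset.powerset_univ, Finset.sum_powerset, Finset.card_univ]
  calc P.real {ω | C (R ω).ncard ∧ Q (R ω)}
      = ∑ r ∈ Finset.range (Fintype.card α + 1), ∑ S ∈ powersetCard r Finset.univ,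
          if C r ∧ Q S then p S else 0 := by
        rw [measureReal_eq_sum_ite hR fun S => C S.ncard ∧ Q S, hsum]
        refine Finset.sum_congr rfl fun r _ => Finset.sum_congr rfl fun S hS => ?_
        rw [Set.ncard_coe_finset, (Finset.mem_powersetCard.1 hS).2]
    _ ≤ ∑ r ∈ Finset.range (Fintype.card α + 1), ε * ∑ S ∈ powersetCard r Finset.univ, p S := by
        refine Finset.sum_le_sum fun r hr => ?_
        have hp0 : 0 ≤ ∑ S ∈ powersetCard r Finset.univ, p S :=
          Finset.sum_nonneg fun _ _ => measureReal_nonneg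
        by_cases hC : C r
        · simp only [hC, true_and, sum_powersetCard_ite_eq_subsetProb_mul hp]
          exact mul_le_mul_of_nonneg_right (hQ r (Finset.mem_range_succ_iff.1 hr) hC) hp0
        · simpa only [hC, false_and, if_false, Finset.sum_const_zero] using mul_nonneg hε hp0
    _ = ε := by
        have htot := measureReal_eq_sum_ite (P := P) hR fun _ => True
        simp only [Set.ofPred_true, probReal_univ, if_true] at htot
        rw [← Finset.mul_sum, ← hsum, ← htot, mul_one]

/-- The probability that a uniformly random `r`-element subset of an `n`-element set contains `i`
given elements, as the product of the conditional probabilities of containing the next one. -/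
noncomputable def containRatio (n r i : ℕ) : ℝ :=
  ∏ j ∈ Finset.range i, ((r - j : ℕ) : ℝ) / (n - j : ℕ)

theorem containRatio_nonneg (n r i : ℕ) : 0 ≤ containRatio n r i :=
  Finset.prod_nonneg fun _ _ => by positivity

theorem sub_div_sub_le_sub_div_sub (h : r ≤ n) {i j : ℕ} (hij : i ≤ j) :
    ((r - j : ℕ) : ℝ) / (n - j : ℕ) ≤ ((r - i : ℕ) : ℝ) / (n - i : ℕ) := by
  rcases le_or_gt r j with hrj | hrj
  · rw [Nat.sub_eq_zero_of_le hrj, Nat.cast_zero, zero_div]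
    positivity
  · have hrn : (r : ℝ) ≤ n := mod_cast h
    have hij' : (i : ℝ) ≤ j := mod_cast hij
    rw [div_le_div_iff₀ (by norm_cast; omega) (by norm_cast; omega)]
    push_cast [hrj.le, hrj.le.trans h, hij.trans hrj.le, (hij.trans hrj.le).trans h]
    nlinarith

theorem containRatio_le_pow (h : r ≤ n) (i : ℕ) : containRatio n r i ≤ ((r : ℝ) / n) ^ i := by
  refine (Finset.prod_le_prod (fun _ _ => by positivity) fun j _ =>
    sub_div_sub_le_sub_div_sub h (Nat.zero_le j)).trans_eq ?_
  rw [Finset.prod_const, Finset.card_range, Nat.sub_zero, Nat.sub_zero]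

theorem containRatio_two_mul_le (h : r ≤ n) (k : ℕ) :
    containRatio n r (2 * k) ≤ containRatio n r k ^ 2 := by
  rw [two_mul, containRatio, Finset.prod_range_add, sq]
  refine mul_le_mul_of_nonneg_left ?_ (containRatio_nonneg n r k)
  exact Finset.prod_le_prod (fun _ _ => by positivity) fun j _ =>
    sub_div_sub_le_sub_div_sub h (Nat.le_add_left j k)

theorem pow_le_containRatio {k : ℕ} (h : r ≤ n) (hk : 2 * k ≤ r) :
    ((r : ℝ) / (2 * n)) ^ k ≤ containRatio n r k := by
  rw [← Finset.card_range k, ← Finset.prod_const, Finset.card_range]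
  refine Finset.prod_le_prod (fun _ _ => by positivity) fun j hj => ?_
  have hj : j < k := Finset.mem_range.1 hj
  have hr : (r : ℝ) ≤ 2 * (r - j : ℕ) := mod_cast (by omega)
  have hn : ((n - j : ℕ) : ℝ) ≤ n := mod_cast n.sub_le j
  have hn0 : (0 : ℝ) < (n - j : ℕ) := mod_cast (by omega)
  rw [div_le_div_iff₀ (by linarith) hn0]
  calc (r : ℝ) * (n - j : ℕ) ≤ 2 * (r - j : ℕ) * n := by gcongr
    _ = (r - j : ℕ) * (2 * n) := by ring

theorem containRatio_eq_choose_div_choose (n r i : ℕ) :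
    containRatio n r i = (r.choose i : ℝ) / n.choose i := by
  have hchoose : ∀ a : ℕ, ∏ j ∈ Finset.range i, ((a - j : ℕ) : ℝ) = i.factorial * a.choose i := by
    intro a
    rw [← Nat.cast_prod, ← Nat.descFactorial_eq_prod_range,
      Nat.descFactorial_eq_factorial_mul_choose, Nat.cast_mul]
  rw [containRatio, Finset.prod_div_distrib, hchoose, hchoose,
    mul_div_mul_left _ _ (mod_cast i.factorial_ne_zero)]

theorem subsetProb_superset (hr : r ≤ Fintype.card α) (T : Finset α) :
    subsetProb r (T ⊆ ·) = containRatio (Fintype.card α) r T.card := by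
  classical
  have hT : T.card ≤ Fintype.card α := T.card_le_univ
  have hcount : ((powersetCard r Finset.univ).filter (T ⊆ ·)).card * (Fintype.card α).choose T.card
      = r.choose T.card * (Fintype.card α).choose r := by
    rcases le_or_gt T.card r with h | h
    · rw [Finset.card_filter_powersetCard_subset _ _ _ T.subset_univ h, Finset.card_univ,
        mul_comm (r.choose _), Nat.choose_mul h, mul_comm]
    · rw [Nat.choose_eq_zero_of_lt h, zero_mul, Finset.filter_eq_empty_iff.2 fun S hS hTS => ?_,
        Finset.card_empty, zero_mul]
      exact h.not_ge ((Finset.card_le_card hTS).trans_eq (Finset.mem_powersetCard.1 hS).2)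
  rw [subsetProb_eq_expect, Finset.expect_eq_sum_div_card, Finset.sum_boole,
    Finset.card_powersetCard,
    Finset.card_univ, containRatio_eq_choose_div_choose,
    div_eq_div_iff (mod_cast (Nat.choose_pos hr).ne') (mod_cast (Nat.choose_pos hT).ne')]
  exact_mod_cast hcount

end UniformSubsets

section SecondMoment

open scoped BigOperators
open Finset (powersetCard)

theorem expect_ite_eq_zero_mul_sq_le {ι : Type*} (s : Finset ι) (X : ι → ℝ) :
    (𝔼 i ∈ s, if X i = 0 then 1 else 0) * (𝔼 i ∈ s, X i) ^ 2 ≤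
      𝔼 i ∈ s, X i ^ 2 - (𝔼 i ∈ s, X i) ^ 2 := by
  rcases s.eq_empty_or_nonempty with rfl | hs
  · simp
  set M := 𝔼 i ∈ s, X i with hM
  calc (𝔼 i ∈ s, if X i = 0 then 1 else 0) * M ^ 2 ≤ 𝔼 i ∈ s, (X i - M) ^ 2 := by
        rw [Finset.expect_mul]
        gcongr with i
        split_ifs with h
        · simp [h]
        · simpa using sq_nonneg (X i - M)
    _ = 𝔼 i ∈ s, X i ^ 2 - M ^ 2 := by
        simp only [sub_sq, Finset.expect_add_distrib, Finset.expect_sub_distrib,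
          Finset.expect_const hs, ← Finset.expect_mul, ← Finset.mul_expect, ← hM]
        ring

variable {α Θ : Type*} [Fintype α] [DecidableEq α] {k r : ℕ}

theorem containRatio_card_union_le {S T : Finset α} (hS : S.card = k) (hT : T.card = k)
    (hr : r ≤ Fintype.card α) (hr0 : 0 < r) :
    containRatio (Fintype.card α) r (S ∪ T).card ≤ containRatio (Fintype.card α) r k ^ 2 +
      if Disjoint S T then 0
      else ((r : ℝ) / Fintype.card α) ^ (2 * k) * ((Fintype.card α : ℝ) / r) ^ (S ∩ T).card := by
  have hcard : (S ∪ T).card + (S ∩ T).card = 2 * k := by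
    rw [Finset.card_union_add_card_inter, hS, hT, two_mul]
  split_ifs with hST
  · rw [Finset.disjoint_iff_inter_eq_empty.1 hST, Finset.card_empty, add_zero] at hcard
    rw [hcard, add_zero]
    exact containRatio_two_mul_le hr k
  · have hn : (0 : ℝ) < Fintype.card α := mod_cast hr0.trans_le hr
    have hr0' : (0 : ℝ) < r := mod_cast hr0
    refine le_add_of_nonneg_of_le (sq_nonneg _) ((containRatio_le_pow hr _).trans_eq ?_)
    rw [← hcard, pow_add, mul_assoc, ← mul_pow, div_mul_div_cancel₀ hn.ne', div_self hr0'.ne',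
      one_pow, mul_one]

variable [Fintype Θ]

theorem expect_sum_superset (hr : r ≤ Fintype.card α) (H : Θ → Finset α) :
    𝔼 S ∈ powersetCard r Finset.univ, ∑ t, (if H t ⊆ S then (1 : ℝ) else 0) =
      ∑ t, containRatio (Fintype.card α) r (H t).card := by
  simp only [Finset.expect_sum_comm, ← subsetProb_superset hr, subsetProb_eq_expect]

theorem expect_sum_superset_sq_le {H : Θ → Finset α} (hH : ∀ t, (H t).card = k)
    (hr : r ≤ Fintype.card α) (hr0 : 0 < r) {ε : ℝ}
    (hε : ∀ t, ∑ t' with ¬ Disjoint (H t) (H t'),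
      ((Fintype.card α : ℝ) / r) ^ (H t ∩ H t').card ≤ ε * Fintype.card Θ) :
    𝔼 S ∈ powersetCard r Finset.univ, (∑ t, if H t ⊆ S then (1 : ℝ) else 0) ^ 2 ≤
      (Fintype.card Θ * containRatio (Fintype.card α) r k) ^ 2 +
        ε * (Fintype.card Θ * ((r : ℝ) / Fintype.card α) ^ k) ^ 2 := by
  calc _ = ∑ t, ∑ t', containRatio (Fintype.card α) r (H t ∪ H t').card := by
        simp only [sq, Finset.sum_mul_sum, ite_mul, one_mul, zero_mul, ← ite_and,
          ← Finset.union_subset_iff]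
        rw [← Fintype.sum_prod_type', ← expect_sum_superset hr]
        simp only [Fintype.sum_prod_type]
    _ ≤ ∑ t, ∑ t', (containRatio (Fintype.card α) r k ^ 2 + if Disjoint (H t) (H t') then 0 else
          ((r : ℝ) / Fintype.card α) ^ (2 * k) *
            ((Fintype.card α : ℝ) / r) ^ (H t ∩ H t').card) := by
        gcongr with t _ t' _
        exact containRatio_card_union_le (hH t) (hH t') hr hr0
    _ ≤ ∑ _t : Θ, (Fintype.card Θ * containRatio (Fintype.card α) r k ^ 2 +
          ((r : ℝ) / Fintype.card α) ^ (2 * k) * (ε * Fintype.card Θ)) := by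
        gcongr with t
        rw [Finset.sum_add_distrib, Finset.sum_const, Finset.card_univ, nsmul_eq_mul]
        simp only [← ite_not (Disjoint _ _), ← Finset.sum_filter, ← Finset.mul_sum]
        gcongr
        exact hε t
    _ = _ := by
        rw [Finset.sum_const, Finset.card_univ, nsmul_eq_mul]
        ring

theorem subsetProb_forall_not_superset_le [Nonempty Θ] {H : Θ → Finset α}
    (hH : ∀ t, (H t).card = k) (hr : r ≤ Fintype.card α) (hk : 2 * k ≤ r) (hr0 : 0 < r) {ε : ℝ}
    (hε : ∀ t, ∑ t' with ¬ Disjoint (H t) (H t'),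
      ((Fintype.card α : ℝ) / r) ^ (H t ∩ H t').card ≤ ε * Fintype.card Θ) :
    subsetProb r (fun S => ∀ t, ¬ H t ⊆ S) ≤ 4 ^ k * ε := by
  let X : Finset α → ℝ := fun S => ∑ t, if H t ⊆ S then 1 else 0
  set M := Fintype.card Θ * containRatio (Fintype.card α) r k with hM
  have hmean : 𝔼 S ∈ powersetCard r Finset.univ, X S = M := by
    simp only [X, expect_sum_superset hr, hH, Finset.sum_const, Finset.card_univ, nsmul_eq_mul, hM]
  have hprob : subsetProb r (fun S => ∀ t, ¬ H t ⊆ S) =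
      𝔼 S ∈ powersetCard r Finset.univ, if X S = 0 then 1 else 0 := by
    simp only [subsetProb_eq_expect, X, Finset.sum_boole, Nat.cast_eq_zero, Finset.card_eq_zero,
      Finset.filter_eq_empty_iff, Finset.mem_univ, true_imp_iff]
  set L := Fintype.card Θ * ((r : ℝ) / Fintype.card α) ^ k with hL
  have hn : (0 : ℝ) < Fintype.card α := mod_cast hr0.trans_le hr
  have hL0 : 0 < L := by have := Fintype.card_pos (α := Θ); positivity
  have hLM : L / 2 ^ k ≤ M := by
    calc L / 2 ^ k = Fintype.card Θ * ((r : ℝ) / (2 * Fintype.card α)) ^ k := by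
          rw [hL, mul_div_assoc, ← div_pow, div_div, mul_comm (Fintype.card α : ℝ)]
      _ ≤ M := by
          rw [hM]
          gcongr
          exact pow_le_containRatio hr hk
  have hchebyshev := expect_ite_eq_zero_mul_sq_le (powersetCard r Finset.univ) X
  rw [← hprob, hmean] at hchebyshev
  have hvar : subsetProb r (fun S => ∀ t, ¬ H t ⊆ S) * M ^ 2 ≤ ε * L ^ 2 := by
    linarith [expect_sum_superset_sq_le hH hr hr0 hε]
  refine le_of_mul_le_mul_right ?_ (by positivity : 0 < (L / 2 ^ k) ^ 2)
  calc subsetProb r (fun S => ∀ t, ¬ H t ⊆ S) * (L / 2 ^ k) ^ 2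
      ≤ subsetProb r (fun S => ∀ t, ¬ H t ⊆ S) * M ^ 2 := by
        gcongr
        exact subsetProb_nonneg _
    _ ≤ ε * L ^ 2 := hvar
    _ = 4 ^ k * ε * (L / 2 ^ k) ^ 2 := by
        rw [show (4 : ℝ) = 2 ^ 2 by norm_num, ← pow_mul, mul_comm 2 k, pow_mul]
        field_simp

end SecondMoment

/-! ### Reduced words -/

section ReducedWords

variable {α : Type*}

/-- The inverse `a⁻¹` of the letter `a`. -/
def letterInv (a : α × Bool) : α × Bool := (a.1, !a.2)

@[simp]
theorem letterInv_letterInv (a : α × Bool) : letterInv (letterInv a) = a := by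
  simp [letterInv]

theorem letterInv_ne (a : α × Bool) : letterInv a ≠ a := fun h =>
  Bool.not_ne_self a.2 (congrArg Prod.snd h)

theorem isReduced_iff_isChain {w : List (α × Bool)} :
    FreeGroup.IsReduced w ↔ w.IsChain (fun a b => b ≠ letterInv a) := by
  have hstep : ∀ a b : α × Bool, (a.1 = b.1 → a.2 = b.2) ↔ b ≠ letterInv a := by
    rintro ⟨i, s⟩ ⟨j, t⟩
    simp only [letterInv, ne_eq, Prod.mk.injEq, not_and, Bool.not_eq_not, @eq_comm _ i,
      @eq_comm _ s]
  simp only [FreeGroup.IsReduced, hstep]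

theorem isCyclicallyReduced_iff_append_self {w : List (α × Bool)} :
    FreeGroup.IsCyclicallyReduced w ↔ FreeGroup.IsReduced (w ++ w) := by
  rw [FreeGroup.IsCyclicallyReduced, FreeGroup.IsReduced, FreeGroup.IsReduced, List.isChain_append]
  tauto

theorem isReduced_invRev {w : List (α × Bool)} (h : FreeGroup.IsReduced w) :
    FreeGroup.IsReduced (FreeGroup.invRev w) := by
  rw [FreeGroup.IsReduced, FreeGroup.invRev, List.isChain_reverse, List.isChain_map]
  exact List.IsChain.imp (fun a b hab hba => by rw [hab hba.symm]) h

theorem isCyclicallyReduced_invRev {w : List (α × Bool)} (h : FreeGroup.IsCyclicallyReduced w) :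
    FreeGroup.IsCyclicallyReduced (FreeGroup.invRev w) := by
  rw [isCyclicallyReduced_iff_append_self] at *
  rw [← FreeGroup.invRev_append]
  exact isReduced_invRev h

theorem getLast?_eq_map_letterInv_head?_invRev (w : List (α × Bool)) :
    w.getLast? = (FreeGroup.invRev w).head?.map letterInv := by
  rw [FreeGroup.invRev, List.head?_reverse, List.getLast?_map, Option.map_map]
  cases w.getLast? <;> simp [letterInv]

variable {m : ℕ}

/-- Enumeration of the `2m - 1` letters that may follow the letter `a` in a reduced word. -/
noncomputable def nextLetter (a : Fin m × Bool) :
    Fin (2 * m - 1) ≃ {b : Fin m × Bool // b ≠ letterInv a} :=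
  (Fintype.equivFinOfCardEq (by
    rw [Fintype.card_subtype_compl]
    simp [mul_comm])).symm

open Classical in
/-- The index of the letter `b` among the letters that may follow the letter `a`. The value at
`b = a⁻¹` is arbitrary. -/
noncomputable def letterCode (a b : Fin m × Bool) : Fin (2 * m - 1) :=
  (nextLetter a).symm (if h : b ≠ letterInv a then ⟨b, h⟩ else ⟨a, (letterInv_ne a).symm⟩)

theorem eq_of_letterCode_eq {a b c : Fin m × Bool} (hb : b ≠ letterInv a) (hc : c ≠ letterInv a)
    (h : letterCode a b = letterCode a c) : b = c := by
  rw [letterCode, letterCode, dif_pos hb, dif_pos hc] at h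
  exact congrArg Subtype.val ((nextLetter a).symm.injective h)

end ReducedWords

section Counting

variable {m : ℕ}

theorem getElem!_succ_ne_letterInv [NeZero m] {w : RelWord m} (hw : FreeGroup.IsReduced w) {j : ℕ}
    (hj : j + 1 < w.length) : w[j + 1]! ≠ letterInv w[j]! := by
  rw [getElem!_pos w _ hj, getElem!_pos w _ (j.lt_succ_self.trans hj)]
  exact List.isChain_iff_getElem.1 (isReduced_iff_isChain.1 hw) j hj

section Tuples

variable {ι : Type*} [Preorder ι] {len : ι → ℕ} {free : ∀ i, Finset (Fin (len i))}
  {𝓡 : Set (ι → RelWord m)}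

theorem eq_of_eq_on_free [NeZero m] [WellFoundedLT ι]
    (hlen : ∀ r ∈ 𝓡, ∀ i, (r i).length = len i) (hred : ∀ r ∈ 𝓡, ∀ i, FreeGroup.IsReduced (r i))
    (hdet : ∀ (i : ι) (j : Fin (len i)), j ∉ free i → ∃ (i' : ι) (j' : ℕ),
      (i' < i ∨ i' = i ∧ j' < j) ∧
      ∀ r ∈ 𝓡, ∀ s ∈ 𝓡, (r i')[j']! = (s i')[j']! → (r i)[(j : ℕ)]! = (s i)[(j : ℕ)]!)
    {r s : ι → RelWord m} (hr : r ∈ 𝓡) (hs : s ∈ 𝓡) (hhead : ∀ i, (r i)[0]! = (s i)[0]!)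
    (hcode : ∀ i, ∀ j ∈ free i, letterCode (r i)[(j - 1 : ℕ)]! (r i)[(j : ℕ)]! =
      letterCode (s i)[(j - 1 : ℕ)]! (s i)[(j : ℕ)]!) : r = s := by
  have hletter : ∀ p : ι ×ₗ ℕ, (r (ofLex p).1)[(ofLex p).2]! = (s (ofLex p).1)[(ofLex p).2]! := by
    intro p
    induction p using WellFoundedLT.induction with
    | ind p ih =>
    obtain ⟨i, j⟩ := p
    change (r i)[j]! = (s i)[j]!
    rcases le_or_gt (len i) j with hj | hj
    · rw [getElem!_neg _ _ (by rw [hlen r hr]; exact hj.not_gt),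
        getElem!_neg _ _ (by rw [hlen s hs]; exact hj.not_gt)]
    by_cases hfree : ⟨j, hj⟩ ∈ free i
    · cases j with
      | zero => exact hhead i
      | succ j =>
        have hprev : (r i)[j]! = (s i)[j]! :=
          ih (toLex (i, j)) (Prod.Lex.toLex_lt_toLex.2 (Or.inr ⟨rfl, j.lt_succ_self⟩))
        have hcode' := hcode i _ hfree
        have hr' := getElem!_succ_ne_letterInv (hred r hr i) (by rwa [hlen r hr])
        have hs' := getElem!_succ_ne_letterInv (hred s hs i) (by rwa [hlen s hs])
        rw [Nat.add_sub_cancel, ← hprev] at hcode'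
        rw [← hprev] at hs'
        exact eq_of_letterCode_eq hr' hs' hcode'
    · obtain ⟨i', j', hlt, hdet'⟩ := hdet i ⟨j, hj⟩ hfree
      exact hdet' r hr s hs (ih (toLex (i', j')) (Prod.Lex.toLex_lt_toLex.2 hlt))
  funext i
  refine List.ext_getElem ((hlen r hr i).trans (hlen s hs i).symm) fun j hj hj' => ?_
  rw [← getElem!_pos (r i) j hj, ← getElem!_pos (s i) j hj']
  exact hletter (toLex (i, j))

theorem ncard_reduced_tuples_le [NeZero m] [Fintype ι]
    (hlen : ∀ r ∈ 𝓡, ∀ i, (r i).length = len i) (hred : ∀ r ∈ 𝓡, ∀ i, FreeGroup.IsReduced (r i))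
    (hdet : ∀ (i : ι) (j : Fin (len i)), j ∉ free i → ∃ (i' : ι) (j' : ℕ),
      (i' < i ∨ i' = i ∧ j' < j) ∧
      ∀ r ∈ 𝓡, ∀ s ∈ 𝓡, (r i')[j']! = (s i')[j']! → (r i)[(j : ℕ)]! = (s i)[(j : ℕ)]!) :
    𝓡.ncard ≤ (2 * m) ^ Fintype.card ι * (2 * m - 1) ^ ∑ i, (free i).card := by
  classical
  let code : (ι → RelWord m) → (ι → Fin m × Bool) × (∀ i, free i → Fin (2 * m - 1)) := fun r =>
    (fun i => (r i)[0]!, fun i j => letterCode (r i)[(j.1 - 1 : ℕ)]! (r i)[(j.1 : ℕ)]!)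
  have hinj : Set.InjOn code 𝓡 := fun r hr s hs hrs =>
    eq_of_eq_on_free hlen hred hdet hr hs (congrFun (congrArg Prod.fst hrs)) fun i j hj =>
      congrFun (congrFun (congrArg Prod.snd hrs) i) ⟨j, hj⟩
  calc 𝓡.ncard = (code '' 𝓡).ncard := hinj.ncard_image.symm
    _ ≤ Nat.card ((ι → Fin m × Bool) × (∀ i, free i → Fin (2 * m - 1))) := Set.ncard_le_card _
    _ = _ := by simp [Fintype.card_pi, Finset.prod_pow_eq_pow_sum, mul_comm m]

end Tuples

theorem ncard_reduced_length_eq_le [NeZero m] (k : ℕ) :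
    {w : RelWord m | FreeGroup.IsReduced w ∧ w.length = k}.ncard ≤ 2 * m * (2 * m - 1) ^ k := by
  have htuples := ncard_reduced_tuples_le (ι := Unit) (len := fun _ => k)
    (free := fun _ => Finset.univ)
    (𝓡 := (fun w _ => w) '' {w : RelWord m | FreeGroup.IsReduced w ∧ w.length = k})
    (by rintro _ ⟨w, hw, rfl⟩ _; exact hw.2) (by rintro _ ⟨w, hw, rfl⟩ _; exact hw.1)
    fun _ j hj => absurd (Finset.mem_univ j) hj
  rw [Set.ncard_image_of_injective _ fun _ _ h => congrFun h ()] at htuples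
  simpa using htuples

theorem card_relBall_le [NeZero m] (ℓ : ℕ) :
    Nat.card (relBall m ℓ) ≤ (ℓ + 1) * (2 * m * (2 * m - 1) ^ ℓ) := by
  have hsub : relBall m ℓ ⊆ ⋃ k ∈ Finset.range (ℓ + 1),
      {w : RelWord m | FreeGroup.IsReduced w ∧ w.length = k} := fun w hw =>
    Set.mem_biUnion (Finset.mem_coe.2 (Finset.mem_range_succ_iff.2 hw.2)) ⟨hw.1.1, rfl⟩
  have hfin : (⋃ k ∈ Finset.range (ℓ + 1),
      {w : RelWord m | FreeGroup.IsReduced w ∧ w.length = k}).Finite :=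
    (Finset.range (ℓ + 1)).finite_toSet.biUnion fun k _ =>
      (List.finite_length_eq _ k).subset fun _ hw => hw.2
  have hm : 0 < m := NeZero.pos m
  calc Nat.card (relBall m ℓ) = (relBall m ℓ).ncard := Nat.card_coe_set_eq _
    _ ≤ ∑ k ∈ Finset.range (ℓ + 1), {w : RelWord m | FreeGroup.IsReduced w ∧ w.length = k}.ncard :=
        (Set.ncard_le_ncard hsub hfin).trans (Finset.set_ncard_biUnion_le _ _)
    _ ≤ ∑ _k ∈ Finset.range (ℓ + 1), 2 * m * (2 * m - 1) ^ ℓ := by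
        refine Finset.sum_le_sum fun k hk => (ncard_reduced_length_eq_le k).trans ?_
        gcongr
        · omega
        · exact Finset.mem_range_succ_iff.1 hk
    _ = _ := by rw [Finset.sum_const, Finset.card_range, smul_eq_mul]

end Counting

section Extending

variable {m : ℕ}

/-- The word read after the letter `a` when the successive letters are chosen according to the
given indices in the enumerations `nextLetter`. -/
noncomputable def extendWord : Fin m × Bool → List (Fin (2 * m - 1)) → RelWord m
  | _, [] => []
  | a, c :: cs => (nextLetter a c).1 :: extendWord (nextLetter a c).1 cs

theorem length_extendWord (a : Fin m × Bool) (cs : List (Fin (2 * m - 1))) :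
    (extendWord a cs).length = cs.length := by
  induction cs generalizing a with
  | nil => rfl
  | cons c cs ih => simp [extendWord, ih]

theorem isReduced_cons_extendWord (a : Fin m × Bool) (cs : List (Fin (2 * m - 1))) :
    FreeGroup.IsReduced (a :: extendWord a cs) := by
  rw [isReduced_iff_isChain]
  induction cs generalizing a with
  | nil => exact List.isChain_singleton a
  | cons c cs ih => exact List.isChain_cons_cons.2 ⟨(nextLetter a c).2, ih _⟩

theorem extendWord_injective (a : Fin m × Bool) : Function.Injective (extendWord a) := by
  intro cs ds h
  induction cs generalizing a ds with
  | nil =>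
    cases ds with
    | nil => rfl
    | cons d ds => simp [extendWord] at h
  | cons c cs ih =>
    cases ds with
    | nil => simp [extendWord] at h
    | cons d ds =>
      obtain ⟨hletter, htail⟩ := List.cons.inj h
      obtain rfl : c = d := (nextLetter a).injective (Subtype.ext hletter)
      rw [ih _ htail]

theorem exists_ne_letterInv_of_two_le (hm : 2 ≤ m) (a b : Fin m × Bool) :
    ∃ z, z ≠ letterInv a ∧ b ≠ letterInv z := by
  by_contra! h
  have hsub : (Finset.univ : Finset (Fin m × Bool)) ⊆ {letterInv a, letterInv b} := by
    intro z _
    rw [Finset.mem_insert, Finset.mem_singleton, or_iff_not_imp_left]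
    exact fun hz => by rw [h z hz, letterInv_letterInv]
  have hcard := (Finset.card_le_card hsub).trans Finset.card_le_two
  rw [Finset.card_univ, Fintype.card_prod, Fintype.card_fin, Fintype.card_bool] at hcard
  omega

theorem exists_injective_reduced_filling (hm : 2 ≤ m) {A B : RelWord m}
    (hA : FreeGroup.IsReduced A) (hA0 : A ≠ []) (hB : FreeGroup.IsReduced B) (hB0 : B ≠ [])
    (k : ℕ) : ∃ fill : (Fin k → Fin (2 * m - 1)) → RelWord m, Function.Injective fill ∧
      ∀ c, (fill c).length = k + 1 ∧ FreeGroup.IsReduced (A ++ fill c ++ B) := by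
  obtain ⟨A, a, rfl⟩ := (List.eq_nil_or_concat A).resolve_left hA0
  obtain ⟨b, B, rfl⟩ := List.exists_cons_of_ne_nil hB0
  choose bridge hbridge hbridge' using exists_ne_letterInv_of_two_le hm
  let last : (Fin k → Fin (2 * m - 1)) → Fin m × Bool := fun c =>
    (a :: extendWord a (List.ofFn c)).getLast (List.cons_ne_nil _ _)
  refine ⟨fun c => extendWord a (List.ofFn c) ++ [bridge (last c) b], fun c d hcd => ?_,
    fun c => ⟨by simp [length_extendWord], ?_⟩⟩
  · exact List.ofFn_injective (extendWord_injective a (List.append_inj_left' hcd rfl))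
  · rw [isReduced_iff_isChain, List.concat_eq_append] at *
    have hleft := List.isChain_split.2
      ⟨hA, isReduced_iff_isChain.1 (isReduced_cons_extendWord a (List.ofFn c))⟩
    have hlast : (A ++ a :: extendWord a (List.ofFn c)).getLast? = some (last c) := by
      rw [List.getLast?_append_of_ne_nil _ (List.cons_ne_nil _ _),
        List.getLast?_eq_some_getLast (List.cons_ne_nil _ _)]
    have happend := List.isChain_append.2 ⟨hleft,
      List.isChain_cons_cons.2 ⟨hbridge' (last c) b, hB⟩, by
        rintro x hx y hy
        rw [hlast, Option.mem_some_iff] at hx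
        rw [List.head?_cons, Option.mem_some_iff] at hy
        rw [← hx, ← hy]
        exact hbridge _ _⟩
    simpa using happend

theorem pow_le_card_relBall (hm : 2 ≤ m) (k : ℕ) :
    (2 * m - 1) ^ k ≤ Nat.card (relBall m (k + 2)) := by
  let a : Fin m × Bool := (⟨0, by omega⟩, true)
  have ha : FreeGroup.IsReduced [a] := isReduced_iff_isChain.2 (List.isChain_singleton a)
  obtain ⟨fill, hinj, hfill⟩ := exists_injective_reduced_filling hm ha (List.cons_ne_nil _ _) ha
    (List.cons_ne_nil _ _) k
  have hmem : ∀ c, a :: fill c ∈ relBall m (k + 2) := by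
    refine fun c => ⟨?_, by simp [(hfill c).1]⟩
    have hclosed := isReduced_iff_isChain.1 (hfill c).2
    rw [isCyclicallyReduced_iff_append_self, isReduced_iff_isChain]
    exact List.isChain_split.2 ⟨hclosed, hclosed.left_of_append⟩
  have := (relBall_finite m (k + 2)).to_subtype
  have hcard := Nat.card_le_card_of_injective (fun c => (⟨_, hmem c⟩ : relBall m (k + 2)))
    fun c d hcd => hinj (List.cons.inj (congrArg Subtype.val hcd)).2
  simpa using hcard

theorem exists_distinct_prefixes (hm : 2 ≤ m) {E : Type*} [Fintype E] (s : E → Fin m × Bool) :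
    ∃ u : E → RelWord m, Function.Injective u ∧ ∀ e, (u e).length = Fintype.card E + 1 ∧
      FreeGroup.IsReduced (u e) ∧ (u e).head? = some (s e) := by
  classical
  have : Nontrivial (Fin (2 * m - 1)) := Fin.nontrivial_iff_two_le.2 (by omega)
  obtain ⟨x, y, hxy⟩ := exists_pair_ne (Fin (2 * m - 1))
  let idx := Fintype.equivFin E
  let digits : E → List (Fin (2 * m - 1)) := fun e => List.ofFn fun i => if i = idx e then x else y
  have hdigits : Function.Injective digits := by
    intro e e' h
    by_contra hne
    have hx := congrFun (List.ofFn_injective h) (idx e)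
    rw [if_pos rfl, if_neg (idx.injective.ne hne)] at hx
    exact hxy hx
  refine ⟨fun e => s e :: extendWord (s e) (digits e), fun e e' h => ?_, fun e => ⟨?_, ?_, rfl⟩⟩
  · obtain ⟨hs, htail⟩ := List.cons.inj h
    rw [hs] at htail
    exact hdigits (extendWord_injective _ htail)
  · simp [length_extendWord, digits]
  · exact isReduced_cons_extendWord _ _

end Extending

/-! ### Counting the labels of a reduced van Kampen 2-complex -/

section RankedFibers

/-- Ranks for the fibers of a map on `F`: they order the fibers lexicographically, first by
decreasing size. -/
abbrev FiberRank (F : Type*) [Fintype F] : Type :=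
  (Fin (Fintype.card F + 1))ᵒᵈ ×ₗ Fin (Fintype.card F)

variable {F K : Type*}

theorem exists_superlevel_sum_nonpos {s : Finset K} (hs : s.Nonempty) {μ : K → ℕ}
    (hμ : ∀ k ∈ s, 0 < μ k) {a : K → ℝ} (h : ∑ k ∈ s, μ k * a k ≤ 0) :
    ∃ t, (s.filter (t < μ ·)).Nonempty ∧ ∑ k ∈ s with t < μ k, a k ≤ 0 := by
  obtain ⟨N, hN⟩ : ∃ N, ∀ k ∈ s, μ k ≤ N := ⟨s.sup μ, fun k hk => Finset.le_sup hk⟩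
  have hlayer : ∀ k ∈ s, (μ k : ℝ) * a k = ∑ t ∈ Finset.range N, if t < μ k then a k else 0 := by
    intro k hk
    have hrange : (Finset.range N).filter (· < μ k) = Finset.range (μ k) := by
      ext t
      have := hN k hk
      simp only [Finset.mem_filter, Finset.mem_range]
      omega
    rw [← Finset.sum_filter, hrange, Finset.sum_const, Finset.card_range, nsmul_eq_mul]
  rw [Finset.sum_congr rfl hlayer, Finset.sum_comm] at h
  by_contra! hpos
  have hzero : s.filter (0 < μ ·) = s := Finset.filter_true_of_mem hμ
  obtain ⟨k, hk⟩ := hs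
  refine h.not_gt (Finset.sum_pos' (fun t _ => ?_) ⟨0, ?_, ?_⟩)
  · rw [← Finset.sum_filter]
    rcases (s.filter (t < μ ·)).eq_empty_or_nonempty with hempty | hne
    · rw [hempty, Finset.sum_empty]
    · exact (hpos t hne).le
  · exact Finset.mem_range.2 ((hμ k hk).trans_le (hN k hk))
  · rw [← Finset.sum_filter]
    exact hpos 0 (hzero.symm ▸ ⟨k, hk⟩)

variable [LinearOrder K]

/-- Fibers of lower rank have at least as many elements in `S`. -/
def FibersDecrease (S : Finset F) (κ : F → K) : Prop :=
  ∀ f g, κ f ≤ κ g → (S.filter (κ · = κ g)).card ≤ (S.filter (κ · = κ f)).card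

theorem exists_fibersDecrease [Fintype F] {W : Type*} (S : Finset F) (w : F → W) :
    ∃ κ : F → FiberRank F, FibersDecrease S κ ∧ ∀ f g, κ f = κ g ↔ w f = w g := by
  classical
  let size : F → Fin (Fintype.card F + 1) := fun f =>
    ⟨(S.filter (w · = w f)).card, Nat.lt_succ_of_le (Finset.card_le_univ _)⟩
  let κ : F → FiberRank F := fun f => toLex (OrderDual.toDual (size f),
    Fintype.equivFin F (Set.rangeSplitting w (Set.rangeFactorization w f)))
  have hκ : ∀ f g, κ f = κ g ↔ w f = w g := by
    refine fun f g => ⟨fun h => ?_, fun h => ?_⟩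
    · have hrep := (Fintype.equivFin F).injective (congrArg (fun p => (ofLex p).2) h)
      exact congrArg Subtype.val (Set.rangeSplitting_injective w hrep)
    · have hrange : Set.rangeFactorization w f = Set.rangeFactorization w g := Subtype.ext h
      simp only [κ, size, h, hrange]
  refine ⟨κ, fun f g h => ?_, hκ⟩
  simp only [hκ]
  exact Prod.Lex.monotone_fst _ _ h

-- A sum over `S` is a combination, with nonnegative weights, of the sums over the initial segments
-- formed by the fibers with more than `t` elements, so one of these sums is not above average.
theorem exists_initial_ranks_sum_le {S : Finset F} (hS : S.Nonempty) {κ : F → K}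
    (hκ : FibersDecrease S κ) {y : F → ℝ} {x : ℝ} (hsum : ∑ f ∈ S, y f ≤ x * S.card) :
    ∃ (J : Finset K) (rep : K → F), J.Nonempty ∧ (∀ k ∈ J, rep k ∈ S ∧ κ (rep k) = k) ∧
      (∀ k ∈ J, ∀ g ∈ S, κ g ≤ k → κ g ∈ J) ∧ ∑ k ∈ J, y (rep k) ≤ x * J.card := by
  classical
  have : Nonempty F := ⟨hS.choose⟩
  have hmin : ∀ k ∈ S.image κ, ∃ f ∈ S.filter (κ · = k), ∀ g ∈ S.filter (κ · = k), y f ≤ y g := by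
    intro k hk
    obtain ⟨f, hf, rfl⟩ := Finset.mem_image.1 hk
    exact Finset.exists_min_image _ y ⟨f, Finset.mem_filter.2 ⟨hf, rfl⟩⟩
  choose! rep hrep hrepmin using hmin
  have hrep' := fun k hk => Finset.mem_filter.1 (hrep k hk)
  have hweighted : ∑ k ∈ S.image κ, ((S.filter (κ · = k)).card : ℝ) * (y (rep k) - x) ≤ 0 :=
    calc _ ≤ ∑ k ∈ S.image κ, ∑ f ∈ S with κ f = k, (y f - x) := by
          refine Finset.sum_le_sum fun k hk => ?_
          rw [← nsmul_eq_mul, ← Finset.sum_const]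
          exact Finset.sum_le_sum fun f hf => sub_le_sub_right (hrepmin k hk f hf) _
      _ = ∑ f ∈ S, y f - x * S.card := by
          rw [Finset.sum_fiberwise_of_maps_to fun f hf => Finset.mem_image_of_mem κ hf,
            Finset.sum_sub_distrib, Finset.sum_const, nsmul_eq_mul, mul_comm x]
      _ ≤ 0 := sub_nonpos.2 hsum
  obtain ⟨t, hne, hle⟩ := exists_superlevel_sum_nonpos (hS.image κ)
    (fun k hk => Finset.card_pos.2 ⟨_, hrep k hk⟩) hweighted
  rw [Finset.sum_sub_distrib, Finset.sum_const, nsmul_eq_mul, mul_comm, sub_nonpos] at hle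
  refine ⟨_, rep, hne, fun k hk => hrep' k (Finset.mem_of_mem_filter k hk),
    fun k hk g hg hgk => ?_, hle⟩
  obtain ⟨hkS, hkt⟩ := Finset.mem_filter.1 hk
  refine Finset.mem_filter.2 ⟨Finset.mem_image_of_mem κ hg, hkt.trans_le ?_⟩
  have hfibers := hκ g (rep k)
  rw [(hrep' k hkS).2] at hfibers
  exact hfibers hgk

end RankedFibers

section FreePositions

variable {V E F K : Type*} [LinearOrder K] {Y : TwoComplex V E F} {m : ℕ}

namespace VanKampenLabeling

variable {R : Set (RelWord m)} (φ : VanKampenLabeling Y R)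

theorem edgeLabel_inv_eq_letterInv (e : E) :
    φ.edgeLabel (Y.inv e) = letterInv (φ.edgeLabel e) :=
  φ.edgeLabel_inv e

theorem length_faceLabel (f : F) : (φ.faceLabel f).length = (Y.bdry f).length := by
  rw [← φ.map_bdry, List.length_map]

theorem getElem?_faceLabel (f : F) (j : Fin (Y.bdry f).length) :
    (φ.faceLabel f)[(j : ℕ)]? = some (φ.edgeLabel (Y.bdry f)[j]) := by
  rw [← φ.map_bdry, List.getElem?_map, List.getElem?_eq_getElem j.2]
  rfl

theorem faceLabel_mem_relBall {ℓ : ℕ} (φ : VanKampenLabeling Y (relBall m ℓ)) (f : F) :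
    φ.faceLabel f ∈ relBall m ℓ := by
  refine (φ.faceLabel_mem f).elim id fun h => ⟨?_, ?_⟩
  · simpa only [FreeGroup.invRev_invRev] using isCyclicallyReduced_invRev h.1
  · simpa only [FreeGroup.invRev_length] using h.2

/-- The van Kampen 2-complex is reduced, and two faces in `S` have the same label if and only if
they have the same rank. -/
def HasType (S : Finset F) (κ : F → K) : Prop :=
  φ.IsReduced ∧ ∀ f ∈ S, ∀ g ∈ S, κ f = κ g ↔ φ.faceLabel f = φ.faceLabel g

end VanKampenLabeling

/-- Up to inversion, the edge at position `j` of the boundary of `f` is also at an earlier position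
of the boundary of a face in `S`; positions are ordered by the rank of the face, then along the
boundary. -/
def OccursEarlier (Y : TwoComplex V E F) (S : Finset F) (κ : F → K) (f : F)
    (j : Fin (Y.bdry f).length) : Prop :=
  ∃ g ∈ S, ∃ i : Fin (Y.bdry g).length, (κ g < κ f ∨ κ g = κ f ∧ (i : ℕ) < j) ∧
    ((Y.bdry g)[i] = (Y.bdry f)[j] ∨ (Y.bdry g)[i] = Y.inv (Y.bdry f)[j])

open Classical in
/-- The positions of the boundary of `f` at which the label of `f` is not determined by labels at
earlier positions. -/
noncomputable def freePositions (Y : TwoComplex V E F) (S : Finset F) (κ : F → K) (f : F) :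
    Finset (Fin (Y.bdry f).length) :=
  Finset.univ.filter fun j => ¬ OccursEarlier Y S κ f j

theorem mem_freePositions {S : Finset F} {κ : F → K} {f : F} {j : Fin (Y.bdry f).length} :
    j ∈ freePositions Y S κ f ↔ ¬ OccursEarlier Y S κ f j := by
  classical
  simp [freePositions]

theorem eq_of_mem_freePositions {R : Set (RelWord m)} {φ : VanKampenLabeling Y R} {S : Finset F}
    {κ : F → K} (hφ : φ.HasType S κ) {f g : F} (hf : f ∈ S) (hg : g ∈ S)
    {j : Fin (Y.bdry f).length} {i : Fin (Y.bdry g).length} (hj : j ∈ freePositions Y S κ f)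
    (hi : i ∈ freePositions Y S κ g)
    (hedge : (Y.bdry g)[i] = (Y.bdry f)[j] ∨ (Y.bdry g)[i] = Y.inv (Y.bdry f)[j]) :
    (⟨f, j⟩ : Σ f, Fin (Y.bdry f).length) = ⟨g, i⟩ ∧ (Y.bdry g)[i] = (Y.bdry f)[j] := by
  have hedge' : (Y.bdry f)[j] = (Y.bdry g)[i] ∨ (Y.bdry f)[j] = Y.inv (Y.bdry g)[i] :=
    hedge.imp Eq.symm fun h => by rw [h, Y.inv_inv]
  have hfg : ¬ (κ g < κ f ∨ κ g = κ f ∧ (i : ℕ) < j) := fun h =>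
    mem_freePositions.1 hj ⟨g, hg, i, h, hedge⟩
  have hgf : ¬ (κ f < κ g ∨ κ f = κ g ∧ (j : ℕ) < i) := fun h =>
    mem_freePositions.1 hi ⟨f, hf, j, h, hedge'⟩
  push Not at hfg hgf
  have hrank : κ f = κ g := le_antisymm hfg.1 hgf.1
  have hpos : (j : ℕ) = i := le_antisymm (hfg.2 hrank.symm) (hgf.2 hrank)
  have hlabel := (hφ.2 f hf g hg).1 hrank
  rcases hedge with h | h
  · have heq : f = g := by
      by_contra hne
      refine hφ.1 f g hne hlabel ⟨j, (Y.bdry f)[j], List.getElem?_eq_getElem j.2, ?_⟩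
      rw [← h]
      exact (congrArg ((Y.bdry g)[·]?) hpos).trans (List.getElem?_eq_getElem i.2)
    subst heq
    exact ⟨by rw [Fin.ext hpos], h⟩
  · have hletters := φ.getElem?_faceLabel g i
    rw [h, φ.edgeLabel_inv_eq_letterInv, ← hpos, ← hlabel, φ.getElem?_faceLabel] at hletters
    exact absurd (Option.some.inj hletters).symm (letterInv_ne _)

theorem two_mul_sum_card_freePositions_le {R : Set (RelWord m)} {φ : VanKampenLabeling Y R}
    {S : Finset F} {κ : F → K} (hφ : φ.HasType S κ) {Z : Y.Sub} (hZ : Z.edges.Finite)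
    (hSZ : (S : Set F) ⊆ Z.faces) :
    2 * ∑ f ∈ S, (freePositions Y S κ f).card ≤ Z.edges.ncard := by
  classical
  let P : Finset (Σ f, Fin (Y.bdry f).length) := S.sigma fun f => freePositions Y S κ f
  let edge : (Σ f, Fin (Y.bdry f).length) → E := fun p => (Y.bdry p.1)[p.2]
  have heq : ∀ p ∈ P, ∀ q ∈ P, edge q = edge p ∨ edge q = Y.inv (edge p) →
      p = q ∧ edge q = edge p := fun p hp q hq =>
    eq_of_mem_freePositions hφ (Finset.mem_sigma.1 hp).1 (Finset.mem_sigma.1 hq).1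
      (Finset.mem_sigma.1 hp).2 (Finset.mem_sigma.1 hq).2
  have hinj : Set.InjOn edge P := fun p hp q hq h => (heq p hp q hq (Or.inl h.symm)).1
  have hinv : Function.Injective Y.inv := Function.LeftInverse.injective Y.inv_inv
  have hdisj : Disjoint (P.image edge) ((P.image edge).image Y.inv) := by
    rw [Finset.disjoint_left]
    intro e he he'
    obtain ⟨q, hq, rfl⟩ := Finset.mem_image.1 he
    obtain ⟨_, hedge, hpq⟩ := Finset.mem_image.1 he'
    obtain ⟨p, hp, rfl⟩ := Finset.mem_image.1 hedge
    have hqp := (heq p hp q hq (Or.inr hpq.symm)).2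
    exact Y.inv_ne (edge p) (hpq.trans hqp)
  have hmem : ∀ e ∈ P.image edge, e ∈ Z.edges := by
    intro e he
    obtain ⟨p, hp, rfl⟩ := Finset.mem_image.1 he
    exact Z.bdry_mem p.1 (hSZ (Finset.mem_sigma.1 hp).1) _ (List.getElem_mem _)
  have hcard : (P.image edge).card = ∑ f ∈ S, (freePositions Y S κ f).card := by
    rw [Finset.card_image_of_injOn hinj, Finset.card_sigma]
  calc 2 * ∑ f ∈ S, (freePositions Y S κ f).card
      = (P.image edge ∪ (P.image edge).image Y.inv).card := by
        rw [Finset.card_union_of_disjoint hdisj, Finset.card_image_of_injective _ hinv, hcard,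
          two_mul]
    _ = ((P.image edge ∪ (P.image edge).image Y.inv : Finset E) : Set E).ncard :=
        (Set.ncard_coe_finset _).symm
    _ ≤ Z.edges.ncard := by
        refine Set.ncard_le_ncard (fun e he => ?_) hZ
        rcases Finset.mem_union.1 (Finset.mem_coe.1 he) with h | h
        · exact hmem e h
        · obtain ⟨e', he', rfl⟩ := Finset.mem_image.1 h
          exact Z.inv_mem e' (hmem e' he')

end FreePositions

section UpperBound

variable {V E F K : Type*} {Y : TwoComplex V E F} {m ℓ : ℕ}

/-- The tuples of relators labeling the faces `rep k`, for `k ∈ J`, in the van Kampen 2-complexes of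
the type given by `S` and `κ`. -/
def labelTuples (Y : TwoComplex V E F) (m ℓ : ℕ) (S : Finset F) (κ : F → K) (J : Finset K)
    (rep : K → F) : Set (J → relBall m ℓ) :=
  {ρ | ∃ φ : VanKampenLabeling Y (relBall m ℓ), φ.HasType S κ ∧
    ∀ k, (ρ k : RelWord m) = φ.faceLabel (rep k)}

theorem injective_of_mem_labelTuples {S : Finset F} {κ : F → K} {J : Finset K} {rep : K → F}
    (hrep : ∀ k ∈ J, rep k ∈ S ∧ κ (rep k) = k) {ρ : J → relBall m ℓ}
    (hρ : ρ ∈ labelTuples Y m ℓ S κ J rep) : Function.Injective ρ := by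
  obtain ⟨φ, hφ, hρφ⟩ := hρ
  intro k k' h
  have hlabel := congrArg Subtype.val h
  rw [hρφ, hρφ, ← hφ.2 _ (hrep k k.2).1 _ (hrep k' k'.2).1, (hrep k k.2).2,
    (hrep k' k'.2).2] at hlabel
  exact Subtype.ext hlabel

variable [LinearOrder K]

theorem ncard_labelTuples_le [NeZero m] {S : Finset F} {κ : F → K} {J : Finset K} {rep : K → F}
    (hrep : ∀ k ∈ J, rep k ∈ S ∧ κ (rep k) = k) (hJ : ∀ k ∈ J, ∀ g ∈ S, κ g ≤ k → κ g ∈ J) :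
    (labelTuples Y m ℓ S κ J rep).ncard ≤
      (2 * m) ^ J.card * (2 * m - 1) ^ ∑ k ∈ J, (freePositions Y S κ (rep k)).card := by
  let words : (J → relBall m ℓ) → J → RelWord m := fun ρ k => ρ k
  have hwords : Function.Injective words := fun ρ ρ' h =>
    funext fun k => Subtype.ext (congrFun h k)
  rw [← Set.ncard_image_of_injective _ hwords, ← Fintype.card_coe J, ← Finset.sum_coe_sort]
  refine ncard_reduced_tuples_le (len := fun k : J => (Y.bdry (rep k)).length)
    (free := fun k : J => freePositions Y S κ (rep k)) ?_ ?_ fun k j hj => ?_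
  · rintro _ ⟨ρ, ⟨φ, -, hρ⟩, rfl⟩ k
    exact (congrArg List.length (hρ k)).trans (φ.length_faceLabel _)
  · rintro _ ⟨ρ, -, rfl⟩ k
    exact (ρ k).2.1.1
  obtain ⟨g, hg, i, hlt, hedge⟩ := not_not.1 (mem_freePositions.not.1 hj)
  rw [(hrep k k.2).2] at hlt
  have hgJ := hJ k k.2 g hg (hlt.elim le_of_lt fun h => h.1.le)
  refine ⟨⟨κ g, hgJ⟩, i, hlt.imp id fun h => ⟨Subtype.ext h.1, h.2⟩, ?_⟩
  have hletters : ∀ ρ ∈ labelTuples Y m ℓ S κ J rep, ∃ φ : VanKampenLabeling Y (relBall m ℓ),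
      (words ρ k)[(j : ℕ)]! = φ.edgeLabel (Y.bdry (rep k))[j] ∧
      (words ρ ⟨κ g, hgJ⟩)[(i : ℕ)]! = φ.edgeLabel (Y.bdry g)[i] := by
    rintro ρ ⟨φ, hφ, hρ⟩
    obtain ⟨hrepS, hrepκ⟩ := hrep (κ g) hgJ
    refine ⟨φ, ?_, ?_⟩
    · rw [List.getElem!_eq_getElem?_getD, show words ρ k = _ from hρ k, φ.getElem?_faceLabel,
        Option.getD_some]
    · rw [List.getElem!_eq_getElem?_getD, show words ρ ⟨κ g, hgJ⟩ = _ from hρ _,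
        (hφ.2 _ hrepS g hg).1 hrepκ, φ.getElem?_faceLabel, Option.getD_some]
  rintro _ ⟨ρ, hρ, rfl⟩ _ ⟨ρ', hρ', rfl⟩ heq
  obtain ⟨φ, hj, hi⟩ := hletters ρ hρ
  obtain ⟨φ', hj', hi'⟩ := hletters ρ' hρ'
  rw [hi, hi'] at heq
  rw [hj, hj']
  rcases hedge with h | h
  · rwa [← h]
  · rw [h, φ.edgeLabel_inv_eq_letterInv, φ'.edgeLabel_inv_eq_letterInv] at heq
    exact Function.LeftInverse.injective letterInv_letterInv heq

theorem exists_ncard_labelTuples_le [NeZero m] {S : Finset F} (hS : S.Nonempty) {κ : F → K}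
    (hκ : FibersDecrease S κ) {φ : VanKampenLabeling Y (relBall m ℓ)} (hφ : φ.HasType S κ)
    {Z : Y.Sub} (hZ : Z.edges.Finite) (hSZ : (S : Set F) ⊆ Z.faces) {x : ℝ}
    (hx : (Z.edges.ncard : ℝ) ≤ 2 * (x * S.card)) :
    ∃ (J : Finset K) (rep : K → F), J.Nonempty ∧ (∀ k ∈ J, rep k ∈ S ∧ κ (rep k) = k) ∧
      ((labelTuples Y m ℓ S κ J rep).ncard : ℝ) ≤
        (2 * m * ((2 * m - 1 : ℕ) : ℝ) ^ x) ^ J.card := by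
  have hfree : ∑ f ∈ S, ((freePositions Y S κ f).card : ℝ) ≤ x * S.card := by
    have := (Nat.cast_le (α := ℝ)).2 (two_mul_sum_card_freePositions_le hφ hZ hSZ)
    push_cast at this
    linarith
  obtain ⟨J, rep, hJ, hrep, hinit, hsum⟩ := exists_initial_ranks_sum_le hS hκ hfree
  have hm : (1 : ℝ) ≤ (2 * m - 1 : ℕ) := by
    have := NeZero.pos m
    exact_mod_cast (by omega : 1 ≤ 2 * m - 1)
  refine ⟨J, rep, hJ, hrep, ?_⟩
  calc ((labelTuples Y m ℓ S κ J rep).ncard : ℝ)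
      ≤ (2 * m) ^ J.card *
        ((2 * m - 1 : ℕ) : ℝ) ^ ∑ k ∈ J, (freePositions Y S κ (rep k)).card := by
        exact_mod_cast ncard_labelTuples_le hrep hinit
    _ ≤ (2 * m) ^ J.card * ((2 * m - 1 : ℕ) : ℝ) ^ (x * J.card) := by
        rw [← Real.rpow_natCast _ (∑ k ∈ J, _)]
        gcongr
        exact_mod_cast hsum
    _ = _ := by rw [mul_pow (2 * (m : ℝ)), Real.rpow_mul (by positivity), Real.rpow_natCast]

variable [Fintype (relBall m ℓ)] {r : ℕ}

theorem subsetProb_exists_hasType_le [NeZero m] {S : Finset F} (hS : S.Nonempty) {κ : F → K}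
    (hκ : FibersDecrease S κ) {Z : Y.Sub} (hZ : Z.edges.Finite) (hSZ : (S : Set F) ⊆ Z.faces)
    {x : ℝ} (hx : (Z.edges.ncard : ℝ) ≤ 2 * (x * S.card)) (hr : r ≤ Fintype.card (relBall m ℓ))
    (hz : 2 * m * ((2 * m - 1 : ℕ) : ℝ) ^ x * (r / Fintype.card (relBall m ℓ)) ≤ 1) :
    subsetProb r (fun Q : Finset (relBall m ℓ) => ∃ φ : VanKampenLabeling Y (relBall m ℓ),
      φ.HasType S κ ∧ ∀ f ∈ S, φ.faceLabel f ∈ relators (Q : Set (relBall m ℓ))) ≤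
      2 * m * ((2 * m - 1 : ℕ) : ℝ) ^ x * (r / Fintype.card (relBall m ℓ)) := by
  classical
  set z := 2 * m * ((2 * m - 1 : ℕ) : ℝ) ^ x * (r / Fintype.card (relBall m ℓ)) with hzdef
  have hz0 : 0 ≤ z := by positivity
  by_cases hφ : ∃ φ : VanKampenLabeling Y (relBall m ℓ), φ.HasType S κ
  swap
  · simpa [subsetProb, not_exists.1 hφ] using hz0
  obtain ⟨φ, hφ⟩ := hφ
  obtain ⟨J, rep, hJ, hrep, hcard⟩ := exists_ncard_labelTuples_le hS hκ hφ hZ hSZ hx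
  let range : (J → relBall m ℓ) → Finset (relBall m ℓ) := fun ρ => Finset.univ.image ρ
  let tuples : Finset (J → relBall m ℓ) := (labelTuples Y m ℓ S κ J rep).toFinset
  have htuples : tuples.card = (labelTuples Y m ℓ S κ J rep).ncard :=
    (Set.ncard_eq_toFinset_card' _).symm
  have hrange : ∀ ρ ∈ tuples, (range ρ).card = J.card := fun ρ hρ => by
    have hinj := injective_of_mem_labelTuples hrep (Set.mem_toFinset.1 hρ)
    rw [Finset.card_image_of_injective _ hinj, Finset.card_univ, Fintype.card_coe]
  have hcover : ∀ Q : Finset (relBall m ℓ), (∃ φ : VanKampenLabeling Y (relBall m ℓ),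
      φ.HasType S κ ∧ ∀ f ∈ S, φ.faceLabel f ∈ relators (Q : Set (relBall m ℓ))) →
      ∃ ρ ∈ tuples, range ρ ⊆ Q := by
    rintro Q ⟨φ, hφ, hQ⟩
    choose ρ hρ hρφ using hQ
    refine ⟨fun k => ρ (rep k) (hrep k k.2).1,
      Set.mem_toFinset.2 ⟨φ, hφ, fun k => hρφ _ (hrep k k.2).1⟩, ?_⟩
    exact Finset.image_subset_iff.2 fun k _ => hρ _ (hrep k k.2).1
  calc _ ≤ ∑ ρ ∈ tuples, subsetProb r (range ρ ⊆ ·) :=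
        (subsetProb_mono hcover).trans (subsetProb_exists_le_sum _ _)
    _ ≤ ∑ _ρ ∈ tuples, ((r : ℝ) / Fintype.card (relBall m ℓ)) ^ J.card := by
        refine Finset.sum_le_sum fun ρ hρ => ?_
        rw [subsetProb_superset hr, hrange ρ hρ]
        exact containRatio_le_pow hr _
    _ ≤ z ^ J.card := by
        rw [Finset.sum_const, nsmul_eq_mul, htuples, hzdef, mul_pow]
        gcongr
    _ ≤ z := pow_le_of_le_one hz0 hz hJ.card_pos.ne'

/-- A van Kampen 2-complex over `R`, regarded as one over a larger set of relators. -/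
def VanKampenLabeling.mono {R R' : Set (RelWord m)} (φ : VanKampenLabeling Y R) (h : R ⊆ R') :
    VanKampenLabeling Y R' where
  edgeLabel := φ.edgeLabel
  faceLabel := φ.faceLabel
  edgeLabel_inv := φ.edgeLabel_inv
  faceLabel_mem := fun f => (φ.faceLabel_mem f).imp (@h _) (@h _)
  faceLabel_finv := φ.faceLabel_finv
  map_bdry := φ.map_bdry

theorem VanKampenLabeling.ncard_faces_le_two_mul {R : Set (RelWord m)} (φ : VanKampenLabeling Y R)
    {Z : Y.Sub} (hZ : Z.faces.Finite) :
    Z.faces.ncard ≤ 2 * {f ∈ Z.faces | φ.faceLabel f ∈ R}.ncard := by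
  have hfinv : Function.Injective Y.finv := Function.LeftInverse.injective Y.finv_finv
  have hfin : {f ∈ Z.faces | φ.faceLabel f ∈ R}.Finite := hZ.subset fun f hf => hf.1
  have hcover : Z.faces ⊆ {f ∈ Z.faces | φ.faceLabel f ∈ R} ∪
      Y.finv '' {f ∈ Z.faces | φ.faceLabel f ∈ R} := by
    intro f hf
    refine (φ.faceLabel_mem f).imp (fun h => ⟨hf, h⟩) fun h =>
      ⟨Y.finv f, ⟨Z.finv_mem f hf, ?_⟩, Y.finv_finv f⟩
    rwa [φ.faceLabel_finv]
  calc Z.faces.ncard ≤ _ := Set.ncard_le_ncard hcover (hfin.union (hfin.image _))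
    _ ≤ _ := Set.ncard_union_le _ _
    _ = _ := by rw [Set.ncard_image_of_injective _ hfinv, two_mul]

theorem subsetProb_fillable_le [NeZero m] [Fintype F] {Z : Y.Sub} (hZ : Z.edges.Finite)
    (hZne : Z.faces.Nonempty) {x : ℝ} (hx : (Z.edges.ncard : ℝ) ≤ x * Z.faces.ncard)
    (hr : r ≤ Fintype.card (relBall m ℓ))
    (hz : 2 * m * ((2 * m - 1 : ℕ) : ℝ) ^ x * (r / Fintype.card (relBall m ℓ)) ≤ 1) :
    subsetProb r (fun Q : Finset (relBall m ℓ) => Fillable Y (relators (Q : Set (relBall m ℓ)))) ≤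
      Nat.card (Finset F × (F → FiberRank F)) *
        (2 * m * ((2 * m - 1 : ℕ) : ℝ) ^ x * (r / Fintype.card (relBall m ℓ))) := by
  classical
  let types : Finset (Finset F × (F → FiberRank F)) := Finset.univ.filter fun τ =>
    ((τ.1 : Set F) ⊆ Z.faces ∧ Z.faces.ncard ≤ 2 * τ.1.card) ∧ FibersDecrease τ.1 τ.2
  have hZpos : 0 < Z.faces.ncard := (Set.ncard_pos).2 hZne
  have hcover : ∀ Q : Finset (relBall m ℓ), Fillable Y (relators (Q : Set (relBall m ℓ))) →
      ∃ τ ∈ types, ∃ φ : VanKampenLabeling Y (relBall m ℓ), φ.HasType τ.1 τ.2 ∧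
        ∀ f ∈ τ.1, φ.faceLabel f ∈ relators (Q : Set (relBall m ℓ)) := by
    rintro Q ⟨φ, hφ⟩
    let S : Finset F :=
      {f ∈ Z.faces | φ.faceLabel f ∈ relators (Q : Set (relBall m ℓ))}.toFinset
    obtain ⟨κ, hκ, hlabel⟩ := exists_fibersDecrease S φ.faceLabel
    have hball : relators (Q : Set (relBall m ℓ)) ⊆ relBall m ℓ := by
      rintro _ ⟨w, -, rfl⟩
      exact w.2
    have hS : Z.faces.ncard ≤ 2 * S.card := by
      rw [← Set.ncard_eq_toFinset_card']
      exact φ.ncard_faces_le_two_mul (Set.toFinite _)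
    refine ⟨(S, κ), Finset.mem_filter.2 ⟨Finset.mem_univ _, ⟨fun f hf => ?_, hS⟩, hκ⟩, φ.mono hball,
      ⟨hφ, fun f _ g _ => hlabel f g⟩, fun f hf => (Set.mem_toFinset.1 hf).2⟩
    exact (Set.mem_toFinset.1 hf).1
  have hx0 : 0 ≤ x :=
    nonneg_of_mul_nonneg_left ((Nat.cast_nonneg _).trans hx) (by exact_mod_cast hZpos)
  set z : ℝ := 2 * m * ((2 * m - 1 : ℕ) : ℝ) ^ x * (r / Fintype.card (relBall m ℓ))
  have : 0 ≤ z := by positivity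
  calc _ ≤ _ := (subsetProb_mono hcover).trans (subsetProb_exists_le_sum _ _)
    _ ≤ types.card • z := by
        refine Finset.sum_le_card_nsmul _ _ _ fun τ hτ => ?_
        obtain ⟨-, ⟨hsub, hcard⟩, hκ⟩ := Finset.mem_filter.1 hτ
        have hcard' : (Z.faces.ncard : ℝ) ≤ 2 * τ.1.card := by exact_mod_cast hcard
        exact subsetProb_exists_hasType_le (Finset.card_pos.1 (by omega)) hκ hZ hsub
          (by nlinarith) hr hz
    _ ≤ _ := by
        rw [nsmul_eq_mul, Nat.card_eq_fintype_card]
        gcongr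
        exact Finset.card_le_univ _

end UpperBound

/-! ### Words on the edges of a subdivided 2-complex -/

section Transversals

variable {E : Type*} {inv : E → E}

theorem exists_transversal [Finite E] (hinv : ∀ e, inv (inv e) = e) (hne : ∀ e, inv e ≠ e) :
    ∃ T : Finset E, ∀ e, inv e ∈ T ↔ e ∉ T := by
  have := Fintype.ofFinite E
  let idx := Fintype.equivFin E
  refine ⟨Finset.univ.filter fun e => idx e < idx (inv e), fun e => ?_⟩
  simp only [Finset.mem_filter, Finset.mem_univ, true_and, hinv, not_lt]
  exact ⟨le_of_lt, fun h => h.lt_of_ne fun h' => hne e (idx.injective h')⟩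

theorem sum_eq_two_mul_sum_transversal [DecidableEq E] (hinv : ∀ e, inv (inv e) = e) {T : Finset E}
    (hT : ∀ e, inv e ∈ T ↔ e ∉ T) {s : Finset E} (hs : ∀ e ∈ s, inv e ∈ s) {g : E → ℝ}
    (hg : ∀ e, g (inv e) = g e) : ∑ e ∈ s, g e = 2 * ∑ e ∈ s with e ∈ T, g e := by
  have hswap : ∑ e ∈ s with e ∉ T, g e = ∑ e ∈ s with e ∈ T, g e := by
    refine Finset.sum_nbij' inv inv (fun e he => ?_) (fun e he => ?_) (fun e _ => hinv e)
      (fun e _ => hinv e) fun e _ => (hg e).symm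
    all_goals rw [Finset.mem_filter] at he ⊢
    · exact ⟨hs e he.1, (hT e).2 he.2⟩
    · exact ⟨hs e he.1, fun h => (hT e).1 h he.2⟩
  rw [← Finset.sum_filter_add_sum_filter_not s (· ∈ T), hswap, two_mul]

end Transversals

section WordFamilies

variable {E : Type*} {m : ℕ} {inv : E → E} {n : E → ℕ} {u : E → RelWord m}

/-- The words `wd e` read along the subdivided edges `e` of a 2-complex whose edges are inverted by
`inv`: `n e` is the number of parts of `e`, and `u e` is a prescribed prefix. -/
structure IsEdgeWords (inv : E → E) (n : E → ℕ) (u wd : E → RelWord m) : Prop where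
  length_eq : ∀ e, (wd e).length = n e
  apply_inv : ∀ e, wd (inv e) = FreeGroup.invRev (wd e)
  isReduced : ∀ e, FreeGroup.IsReduced (wd e)
  isPrefix : ∀ e, u e <+: wd e

theorem exists_injective_word_of_prefixes (hm : 2 ≤ m) {A B : RelWord m}
    (hA : FreeGroup.IsReduced A) (hB : FreeGroup.IsReduced B) {k : ℕ} (hk : 0 < k)
    (hAk : A.length = k) (hBk : B.length = k) {N : ℕ} (hN : 2 * k + 1 ≤ N) :
    ∃ word : (Fin (N - (2 * k + 1)) → Fin (2 * m - 1)) → RelWord m, Function.Injective word ∧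
      ∀ c, (word c).length = N ∧ FreeGroup.IsReduced (word c) ∧ A <+: word c ∧
        B <+: FreeGroup.invRev (word c) := by
  obtain ⟨fill, hinj, hfill⟩ := exists_injective_reduced_filling hm hA
    (List.ne_nil_of_length_pos (hAk ▸ hk)) (isReduced_invRev hB)
    (List.ne_nil_of_length_pos (by rwa [FreeGroup.invRev_length, hBk])) (N - (2 * k + 1))
  refine ⟨fun c => A ++ fill c ++ FreeGroup.invRev B, fun c c' h =>
    hinj (List.append_cancel_left (List.append_cancel_right h)), fun c => ⟨?_, (hfill c).2, ?_, ?_⟩⟩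
  · simp only [List.length_append, FreeGroup.invRev_length, hAk, hBk, (hfill c).1]
    omega
  · exact (List.prefix_append _ _).trans (List.prefix_append _ _)
  · simp only [FreeGroup.invRev_append, FreeGroup.invRev_invRev, List.prefix_append]

variable {T : Finset E}

/-- The extension, compatible with inversion, of words given on a set `T` containing one orientation
of every edge. -/
def symmetrizeWords [DecidableEq E] (inv : E → E) (w : T → RelWord m) (e : E) : RelWord m :=
  if h : e ∈ T then w ⟨e, h⟩
  else if h : inv e ∈ T then FreeGroup.invRev (w ⟨inv e, h⟩) else []

theorem isEdgeWords_symmetrizeWords [DecidableEq E] (hinv : ∀ e, inv (inv e) = e)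
    (hT : ∀ e, inv e ∈ T ↔ e ∉ T) (hninv : ∀ e, n (inv e) = n e) {w : T → RelWord m}
    (hlen : ∀ e, (w e).length = n e)
    (hred : ∀ e, FreeGroup.IsReduced (w e)) (hpre : ∀ e : T, u e <+: w e)
    (hsuf : ∀ e : T, u (inv e) <+: FreeGroup.invRev (w e)) :
    IsEdgeWords inv n u (symmetrizeWords inv w) := by
  have hcases : ∀ e, (∃ h : e ∈ T, symmetrizeWords inv w e = w ⟨e, h⟩) ∨
      ∃ h : inv e ∈ T, symmetrizeWords inv w e = FreeGroup.invRev (w ⟨inv e, h⟩) := fun e => by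
    by_cases h : e ∈ T
    · exact Or.inl ⟨h, dif_pos h⟩
    · exact Or.inr ⟨(hT e).2 h, (dif_neg h).trans (dif_pos _)⟩
  refine ⟨fun e => ?_, fun e => ?_, fun e => ?_, fun e => ?_⟩
  · rcases hcases e with ⟨h, he⟩ | ⟨h, he⟩
    · rw [he, hlen]
    · rw [he, FreeGroup.invRev_length, hlen, hninv]
  · by_cases h : e ∈ T
    · simp only [symmetrizeWords, h, mt (hT e).1 (not_not.2 h), hinv, dite_true, dite_false]
    · simp only [symmetrizeWords, h, (hT e).2 h, dite_true, dite_false, FreeGroup.invRev_invRev]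
  · rcases hcases e with ⟨h, he⟩ | ⟨h, he⟩
    · exact he ▸ hred _
    · exact he ▸ isReduced_invRev (hred _)
  · rcases hcases e with ⟨h, he⟩ | ⟨h, he⟩
    · exact he ▸ hpre ⟨e, h⟩
    · simpa only [he, hinv] using hsuf ⟨inv e, h⟩

theorem exists_edgeWord_family (hm : 2 ≤ m) (hinv : ∀ e, inv (inv e) = e)
    (hT : ∀ e, inv e ∈ T ↔ e ∉ T) (hninv : ∀ e, n (inv e) = n e) {k : ℕ} (hk : 0 < k)
    (hn : ∀ e, 2 * k + 1 ≤ n e) (hu : ∀ e, (u e).length = k ∧ FreeGroup.IsReduced (u e)) :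
    ∃ wd : ((e : T) → Fin (n e - (2 * k + 1)) → Fin (2 * m - 1)) → E → RelWord m,
      (∀ t, IsEdgeWords inv n u (wd t)) ∧ ∀ t t', ∀ e : T, wd t e = wd t' e → t e = t' e := by
  choose word word_injective hword using fun e : T => exists_injective_word_of_prefixes hm
    (hu e).2 (hu (inv e)).2 hk (hu e).1 (hu (inv e)).1 (hn e)
  classical
  refine ⟨fun t => symmetrizeWords inv fun e => word e (t e), fun t =>
    isEdgeWords_symmetrizeWords hinv hT hninv (fun e => (hword e _).1) (fun e => (hword e _).2.1)
      (fun e => (hword e _).2.2.1) fun e => (hword e _).2.2.2, fun t t' e h => ?_⟩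
  simp only [symmetrizeWords, e.2, dite_true] at h
  exact word_injective e h

end WordFamilies

section Concatenation

variable {E : Type*} {m : ℕ} {inv : E → E}

theorem flatMap_injective_of_prefix {u : E → RelWord m} (hu : Function.Injective u) {k : ℕ}
    (hk : 0 < k) (hlen : ∀ e, (u e).length = k) {wd : E → RelWord m} (hwd : ∀ e, u e <+: wd e) :
    Function.Injective fun l : List E => l.flatMap wd := by
  have hpos : ∀ e, 0 < (wd e).length := fun e =>
    (hk.trans_eq (hlen e).symm).trans_le (hwd e).length_le
  intro l l' h
  induction l generalizing l' with
  | nil =>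
    cases l' with
    | nil => rfl
    | cons b l' =>
      have := hpos b
      simp_all
  | cons a l ih =>
    cases l' with
    | nil =>
      have := hpos a
      simp_all
    | cons b l' =>
      simp only [List.flatMap_cons] at h
      have hab : u a <+: u b := List.prefix_of_prefix_length_le
        ((hwd a).trans (List.prefix_append _ _)) (h ▸ (hwd b).trans (List.prefix_append _ _))
        (by rw [hlen, hlen])
      obtain rfl : a = b := hu (hab.eq_of_length (by rw [hlen, hlen]))
      rw [ih (List.append_cancel_left h)]

theorem eq_of_flatMap_eq {wd wd' : E → RelWord m} (hlen : ∀ e, (wd e).length = (wd' e).length)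
    {l : List E} (h : l.flatMap wd = l.flatMap wd') : ∀ e ∈ l, wd e = wd' e := by
  induction l with
  | nil => simp
  | cons a l ih =>
    obtain ⟨ha, hl⟩ := List.append_inj h (hlen a)
    exact List.forall_mem_cons.2 ⟨ha, ih hl⟩

theorem isReduced_flatMap_congr {wd wd' : E → RelWord m} (hne : ∀ e, wd e ≠ [])
    (hne' : ∀ e, wd' e ≠ []) (hred : ∀ e, FreeGroup.IsReduced (wd' e))
    (hhead : ∀ e, (wd e).head? = (wd' e).head?)
    (hlast : ∀ e, (wd e).getLast? = (wd' e).getLast?) {l : List E}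
    (h : FreeGroup.IsReduced (l.flatMap wd)) : FreeGroup.IsReduced (l.flatMap wd') := by
  have hmem : ∀ {v : E → RelWord m}, (∀ e, v e ≠ []) → [] ∉ l.map v := fun hv h => by
    obtain ⟨e, -, he⟩ := List.mem_map.1 h
    exact hv e he
  rw [FreeGroup.IsReduced, List.flatMap_def, List.isChain_flatten (hmem hne),
    List.isChain_map] at h
  rw [FreeGroup.IsReduced, List.flatMap_def, List.isChain_flatten (hmem hne'), List.isChain_map]
  refine ⟨List.forall_mem_map.2 fun e _ => hred e, ?_⟩
  simpa only [hhead, hlast] using h.2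

theorem flatMap_invRev {wd : E → RelWord m}
    (hinv : ∀ e, wd (inv e) = FreeGroup.invRev (wd e)) (l : List E) :
    (l.map inv).reverse.flatMap wd = FreeGroup.invRev (l.flatMap wd) := by
  induction l with
  | nil => rfl
  | cons a l ih =>
    rw [List.map_cons, List.reverse_cons, List.flatMap_append, ih, List.flatMap_singleton,
      List.flatMap_cons, FreeGroup.invRev_append, hinv]

end Concatenation

section Subdivision

variable {V E F : Type*} {Y : TwoComplex V E F} {m ℓ : ℕ}

theorem VanKampenLabeling.IsReduced.bdry_injective {R : Set (RelWord m)}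
    {φ : VanKampenLabeling Y R} (hφ : φ.IsReduced) : Function.Injective Y.bdry := by
  intro f g hfg
  by_contra hne
  obtain ⟨e, l, hel⟩ := List.exists_cons_of_ne_nil (Y.bdry_ne_nil f)
  refine hφ f g hne (by rw [← φ.map_bdry, ← φ.map_bdry, hfg]) ⟨0, e, ?_, ?_⟩
  · rw [hel, List.getElem?_cons_zero]
  · rw [← hfg, hel, List.getElem?_cons_zero]

variable {n : E → ℕ} {hinv : ∀ e, n (Y.inv e) = n e} {hn : ∀ e, 0 < n e} {R : Set (RelWord m)}

/-- The van Kampen 2-complex whose underlying 2-complex is a subdivision of `Y`, with the word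
`wd e` along the edge `e` of `Y`. -/
def labelingOfEdgeWords (Y : TwoComplex V E F) (hinv : ∀ e, n (Y.inv e) = n e)
    (hn : ∀ e, 0 < n e) {u wd : E → RelWord m} (hwd : IsEdgeWords Y.inv n u wd)
    (hR : ∀ f, (Y.bdry f).flatMap wd ∈ R ∨ FreeGroup.invRev ((Y.bdry f).flatMap wd) ∈ R) :
    VanKampenLabeling (Y.subdivide n hinv hn) R where
  edgeLabel := fun p => (wd p.1.1)[p.1.2]'(by rw [hwd.length_eq]; exact p.2)
  faceLabel := fun f => (Y.bdry f).flatMap wd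
  edgeLabel_inv := by
    rintro ⟨⟨e, i⟩, hi⟩
    have hi' : i < n e := hi
    have hreflect : n e - 1 - (n e - 1 - i) = i := by omega
    change (wd (Y.inv e))[n e - 1 - i]'_ = letterInv ((wd e)[i]'_)
    simp only [hwd.apply_inv, FreeGroup.invRev, List.getElem_reverse, List.getElem_map, letterInv,
      List.length_map, hwd.length_eq, hreflect]
  faceLabel_mem := hR
  faceLabel_finv := fun f => by
    rw [show (Y.subdivide n hinv hn).finv f = Y.finv f from rfl, Y.bdry_finv,
      flatMap_invRev hwd.apply_inv]
  map_bdry := fun f => by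
    change ((Y.bdry f).flatMap (TwoComplex.arc n)).map _ = _
    rw [List.map_flatMap]
    congr 1
    funext e
    refine List.ext_getElem (by simp [TwoComplex.arc_length, hwd.length_eq]) fun i _ _ => ?_
    simp [TwoComplex.arc]

theorem fillable_subdivide_of_edgeWords {u wd : E → RelWord m} (hwd : IsEdgeWords Y.inv n u wd)
    (hinj : Function.Injective fun f => (Y.bdry f).flatMap wd) {A : Finset F}
    (hA : ∀ f, Y.finv f ∈ A ↔ f ∉ A) (hR : ∀ f ∈ A, (Y.bdry f).flatMap wd ∈ R) :
    Fillable (Y.subdivide n hinv hn) R := by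
  refine ⟨labelingOfEdgeWords Y hinv hn hwd fun f => ?_,
    fun f g hfg h => absurd (hinj h) hfg⟩
  by_cases hf : f ∈ A
  · exact Or.inl (hR f hf)
  · rw [← flatMap_invRev hwd.apply_inv, ← Y.bdry_finv]
    exact Or.inr (hR _ ((hA f).2 hf))

/-- The word along the edge `e` of `Y` in a van Kampen 2-complex whose underlying 2-complex is a
subdivision of `Y`. -/
def edgeWord (φ : VanKampenLabeling (Y.subdivide n hinv hn) R) (e : E) : RelWord m :=
  (TwoComplex.arc n e).map φ.edgeLabel

variable (φ : VanKampenLabeling (Y.subdivide n hinv hn) R)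

theorem length_edgeWord (e : E) : (edgeWord φ e).length = n e := by
  rw [edgeWord, List.length_map, TwoComplex.arc_length]

theorem edgeWord_ne_nil (e : E) : edgeWord φ e ≠ [] :=
  List.ne_nil_of_length_pos (length_edgeWord φ e ▸ hn e)

theorem edgeWord_inv (e : E) : edgeWord φ (Y.inv e) = FreeGroup.invRev (edgeWord φ e) := by
  rw [edgeWord, edgeWord, TwoComplex.arc_inv Y hinv, FreeGroup.invRev, List.map_reverse,
    List.map_map, List.map_map]
  congr 2
  funext p
  exact φ.edgeLabel_inv p

theorem faceLabel_eq_flatMap (f : F) : φ.faceLabel f = (Y.bdry f).flatMap (edgeWord φ) := by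
  rw [← φ.map_bdry]
  exact List.map_flatMap

theorem flatMap_mem_relBall_of_edgeWords (φ : VanKampenLabeling (Y.subdivide n hinv hn)
    (relBall m ℓ)) {u wd : E → RelWord m} (hwd : IsEdgeWords Y.inv n u wd)
    (hu : ∀ e, (u e).head? = (edgeWord φ e).head?) (f : F) :
    (Y.bdry f).flatMap wd ∈ relBall m ℓ := by
  have hhead : ∀ e, (edgeWord φ e).head? = (wd e).head? := fun e => by
    obtain ⟨a, l, hal⟩ := List.exists_cons_of_ne_nil (edgeWord_ne_nil φ e)
    obtain ⟨v, hv⟩ := hwd.isPrefix e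
    have := hu e
    rw [← hv, List.head?_append, this, hal, List.head?_cons, Option.some_or]
  have hlast : ∀ e, (edgeWord φ e).getLast? = (wd e).getLast? := fun e => by
    rw [getLast?_eq_map_letterInv_head?_invRev, getLast?_eq_map_letterInv_head?_invRev (wd e),
      ← hwd.apply_inv, ← edgeWord_inv, hhead]
  have hne : ∀ e, wd e ≠ [] := fun e => List.ne_nil_of_length_pos (hwd.length_eq e ▸ hn e)
  have hball := φ.faceLabel_mem_relBall f
  rw [faceLabel_eq_flatMap] at hball
  refine ⟨?_, hball.2.trans_eq' ?_⟩
  · rw [isCyclicallyReduced_iff_append_self, ← List.flatMap_append]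
    refine isReduced_flatMap_congr (edgeWord_ne_nil φ) hne hwd.isReduced hhead hlast ?_
    rw [List.flatMap_append, ← isCyclicallyReduced_iff_append_self]
    exact hball.1
  · simp only [List.length_flatMap, length_edgeWord, hwd.length_eq]

theorem exists_label_family [Fintype E] (hm : 2 ≤ m)
    (hnE : ∀ e, 2 * Fintype.card E + 3 ≤ n e)
    (hfill : Fillable (Y.subdivide n hinv hn) (relBall m ℓ)) {A : Finset F}
    (hA : ∀ f, Y.finv f ∈ A ↔ f ∉ A) {T : Finset E} (hT : ∀ e, Y.inv e ∈ T ↔ e ∉ T) :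
    ∃ lab : ((e : T) → Fin (n e - (2 * Fintype.card E + 3)) → Fin (2 * m - 1)) → F → relBall m ℓ,
      (∀ t, Function.Injective (lab t)) ∧
      (∀ t R, (∀ f ∈ A, (lab t f : RelWord m) ∈ R) → Fillable (Y.subdivide n hinv hn) R) ∧
      ∀ t t' f, lab t f = lab t' f → ∀ e : T, ↑e ∈ Y.bdry f ∨ Y.inv e ∈ Y.bdry f → t e = t' e := by
  classical
  obtain ⟨φ, hφ⟩ := hfill
  obtain ⟨u, u_injective, hu⟩ :=
    exists_distinct_prefixes hm fun e => (edgeWord φ e).head (edgeWord_ne_nil φ e)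
  obtain ⟨wd, hwd, digits_eq⟩ := exists_edgeWord_family hm Y.inv_inv hT hinv
    (Nat.succ_pos (Fintype.card E)) hnE fun e => ⟨(hu e).1, (hu e).2.1⟩
  have hball : ∀ t f, (Y.bdry f).flatMap (wd t) ∈ relBall m ℓ := fun t =>
    flatMap_mem_relBall_of_edgeWords φ (hwd t) fun e => by
      rw [(hu e).2.2, List.head?_eq_some_head]
  have bdry_injective : Function.Injective Y.bdry := fun f g h =>
    hφ.bdry_injective (congrArg (List.flatMap (TwoComplex.arc n)) h)
  have hinj : ∀ t, Function.Injective fun f => (Y.bdry f).flatMap (wd t) := fun t =>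
    (flatMap_injective_of_prefix u_injective (Nat.succ_pos _) (fun e => (hu e).1)
      (hwd t).isPrefix).comp bdry_injective
  refine ⟨fun t f => ⟨_, hball t f⟩, fun t f g h => hinj t (congrArg Subtype.val h),
    fun t R => fillable_subdivide_of_edgeWords (hwd t) (hinj t) hA, fun t t' f h e he => ?_⟩
  have hword := eq_of_flatMap_eq (fun e => by rw [(hwd t).length_eq, (hwd t').length_eq])
    (congrArg Subtype.val h)
  refine digits_eq t t' e (he.elim (hword e) fun he => ?_)
  rw [← Y.inv_inv e, (hwd t).apply_inv, (hwd t').apply_inv, hword _ he]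

end Subdivision

/-! ### The lower bound for the probability of filling -/

section Overlaps

open Finset (image)

variable {Θ F α : Type*} [DecidableEq α] {lab : Θ → F → α} {A : Finset F}

theorem exists_card_inter_image_eq (hlab : ∀ t, Function.Injective (lab t)) {t t' : Θ}
    (h : ¬ Disjoint (A.image (lab t)) (A.image (lab t'))) :
    ∃ J ⊆ A, J.Nonempty ∧ ∃ π : F → F, (∀ g ∈ J, lab t' g = lab t (π g)) ∧
      (A.image (lab t) ∩ A.image (lab t')).card = J.card := by
  classical
  let J := A.filter fun g => lab t' g ∈ A.image (lab t)
  have hinter : A.image (lab t) ∩ A.image (lab t') = J.image (lab t') := by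
    ext w
    simp only [J, Finset.mem_inter, Finset.mem_image (f := lab t'), Finset.mem_filter]
    exact ⟨fun ⟨hw, f, hf, hfw⟩ => ⟨f, ⟨hf, hfw ▸ hw⟩, hfw⟩,
      fun ⟨f, ⟨hf, hw⟩, hfw⟩ => ⟨hfw ▸ hw, f, hf, hfw⟩⟩
  have hpartner : ∀ g ∈ J, ∃ f, lab t' g = lab t f := fun g hg => by
    obtain ⟨f, -, hf⟩ := Finset.mem_image.1 (Finset.mem_filter.1 hg).2
    exact ⟨f, hf.symm⟩
  choose! π hπ using hpartner
  refine ⟨J, Finset.filter_subset _ _, ?_, π, hπ, ?_⟩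
  · rwa [Finset.disjoint_iff_inter_eq_empty, hinter, Finset.image_eq_empty,
      ← Finset.not_nonempty_iff_eq_empty, not_not] at h
  · rw [hinter, Finset.card_image_of_injective _ (hlab t')]

open Classical in
theorem sum_pow_card_inter_image_le [Fintype Θ] [Fintype F]
    (hlab : ∀ t, Function.Injective (lab t)) {y b : ℝ}
    (hy : 0 ≤ y) (hb0 : 0 ≤ b) (hb : ∀ J ⊆ A, J.Nonempty → ∀ ρ : F → α,
      ((Finset.univ.filter fun t => ∀ g ∈ J, lab t g = ρ g).card : ℝ) * y ^ J.card ≤ b) (t : Θ) :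
    ∑ t' with ¬ Disjoint (A.image (lab t)) (A.image (lab t')),
      y ^ (A.image (lab t) ∩ A.image (lab t')).card ≤ Nat.card (Finset F × (F → F)) * b := by
  let overlaps : Finset (Finset F × (F → F)) := {τ | τ.1 ⊆ A ∧ τ.1.Nonempty}
  let agreeing : Finset F × (F → F) → Finset Θ := fun τ =>
    {t' | ∀ g ∈ τ.1, lab t' g = lab t (τ.2 g)}
  have hnonneg : ∀ (t' : Θ) (τ : Finset F × (F → F)),
      0 ≤ if t' ∈ agreeing τ then y ^ τ.1.card else 0 := fun t' τ => by positivity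
  calc _ ≤ ∑ t' with ¬ Disjoint (A.image (lab t)) (A.image (lab t')),
        ∑ τ ∈ overlaps, if t' ∈ agreeing τ then y ^ τ.1.card else 0 := by
        refine Finset.sum_le_sum fun t' ht' => ?_
        obtain ⟨J, hJA, hJ, π, hπ, hcard⟩ :=
          exists_card_inter_image_eq hlab (Finset.mem_filter.1 ht').2
        refine le_of_eq_of_le ?_ (Finset.single_le_sum (fun τ _ => hnonneg t' τ)
          (Finset.mem_filter.2 ⟨Finset.mem_univ (J, π), hJA, hJ⟩))
        rw [if_pos (Finset.mem_filter.2 ⟨Finset.mem_univ _, hπ⟩), hcard]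
    _ ≤ ∑ t', ∑ τ ∈ overlaps, if t' ∈ agreeing τ then y ^ τ.1.card else 0 :=
        Finset.sum_le_sum_of_subset_of_nonneg (Finset.filter_subset _ _)
          fun t' _ _ => Finset.sum_nonneg fun τ _ => hnonneg t' τ
    _ = ∑ τ ∈ overlaps, ((agreeing τ).card : ℝ) * y ^ τ.1.card := by
        rw [Finset.sum_comm]
        simp only [Finset.sum_ite_mem, Finset.univ_inter, Finset.sum_const, nsmul_eq_mul]
    _ ≤ overlaps.card • b := Finset.sum_le_card_nsmul _ _ _ fun τ hτ =>
        hb _ (Finset.mem_filter.1 hτ).2.1 (Finset.mem_filter.1 hτ).2.2 _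
    _ ≤ _ := by
        rw [nsmul_eq_mul, Nat.card_eq_fintype_card]
        gcongr
        exact Finset.card_le_univ _

end Overlaps

theorem card_mul_pow_le_of_agree {ι : Type*} [Fintype ι] [DecidableEq ι] {ν : ι → ℕ} {q : ℕ}
    {B : Finset ι} {G : Finset ((i : ι) → Fin (ν i) → Fin q)}
    (hG : ∀ t ∈ G, ∀ t' ∈ G, ∀ i ∈ B, t i = t' i) :
    G.card * q ^ ∑ i ∈ B, ν i ≤ Fintype.card ((i : ι) → Fin (ν i) → Fin q) := by
  have hinj : Set.InjOn (fun t (i : (Bᶜ : Finset ι)) => t i)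
      (G : Set ((i : ι) → Fin (ν i) → Fin q)) := by
    intro t ht t' ht' h
    funext i
    by_cases hi : i ∈ B
    · exact hG t ht t' ht' i hi
    · exact congrFun h ⟨i, Finset.mem_compl.2 hi⟩
  have hcard : G.card ≤ ∏ i ∈ Bᶜ, q ^ ν i := by
    refine (Finset.card_le_card_of_injOn _ (fun _ _ => Finset.mem_univ _) hinj).trans_eq ?_
    rw [Finset.card_univ, Fintype.card_pi, ← Finset.prod_coe_sort Bᶜ fun i => q ^ ν i]
    simp
  calc _ ≤ (∏ i ∈ Bᶜ, q ^ ν i) * ∏ i ∈ B, q ^ ν i := by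
        rw [Finset.prod_pow_eq_pow_sum B]
        gcongr
    _ = _ := by
        rw [Finset.prod_compl_mul_prod]
        simp

theorem mul_pow_le_of_mul_pow_le {g a y q x : ℝ} {s c : ℕ} (hg : 0 ≤ g) (hy : 0 ≤ y) (hq : 1 ≤ q)
    (hgs : g * q ^ s ≤ a) (hx : x * c ≤ s) (hz : y * q ^ (-x) ≤ 1) (hc : c ≠ 0) :
    g * y ^ c ≤ y * q ^ (-x) * a := by
  have hq0 : 0 < q := by linarith
  have hcancel : y ^ c = (y * q ^ (-x)) ^ c * q ^ (x * c) := by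
    rw [mul_pow, ← Real.rpow_natCast (q ^ (-x)), ← Real.rpow_mul hq0.le, mul_assoc,
      ← Real.rpow_add hq0, neg_mul, neg_add_cancel, Real.rpow_zero, mul_one]
  have hpow : q ^ (x * c) ≤ q ^ s := by
    rw [← Real.rpow_natCast q s]
    exact Real.rpow_le_rpow_of_exponent_le hq hx
  calc g * y ^ c = (y * q ^ (-x)) ^ c * (g * q ^ (x * c)) := by rw [hcancel]; ring
    _ ≤ y * q ^ (-x) * a := by
        gcongr
        · exact pow_le_of_le_one (by positivity) hz hc
        · exact (mul_le_mul_of_nonneg_left hpow hg).trans hgs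

section LowerBound

variable {V E F : Type*} {m ℓ r : ℕ}

/-- The sub-2-complex spanned by a set of faces. It contains every vertex of `Y`, as vertices do not
contribute to the density. -/
def TwoComplex.Sub.ofFaces (Y : TwoComplex V E F) (J : Set F) : Y.Sub where
  verts := Set.univ
  edges := {e | ∃ f ∈ J, e ∈ Y.bdry f ∨ Y.inv e ∈ Y.bdry f}
  faces := {f | f ∈ J ∨ Y.finv f ∈ J}
  src_mem := fun _ _ => Set.mem_univ _
  tgt_mem := fun _ _ => Set.mem_univ _
  inv_mem := by
    rintro e ⟨f, hf, he⟩
    exact ⟨f, hf, by rwa [Y.inv_inv, or_comm]⟩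
  finv_mem := fun f hf => by rwa [Set.mem_ofPred_eq, Y.finv_finv, or_comm]
  bdry_mem := by
    rintro f (hf | hf) e he
    · exact ⟨f, hf, Or.inl he⟩
    · refine ⟨_, hf, Or.inr ?_⟩
      rw [Y.bdry_finv, List.mem_reverse]
      exact List.mem_map_of_mem he

variable {Y : TwoComplex V E F} {n : E → ℕ}

open Classical in
theorem mul_card_le_sum_transversal [Finite E] [Finite F] (hinv : ∀ e, n (Y.inv e) = n e) {c : ℕ}
    (hc : ∀ e, c ≤ n e) {x : ℝ} (hx : ∀ Z : Y.Sub, Z.faces.Nonempty →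
      x * Z.faces.ncard ≤ ∑ᶠ e ∈ Z.edges, ((n e : ℝ) - c))
    {A : Finset F} (hA : ∀ f, Y.finv f ∈ A ↔ f ∉ A) {T : Finset E}
    (hT : ∀ e, Y.inv e ∈ T ↔ e ∉ T) {J : Finset F} (hJA : J ⊆ A) (hJ : J.Nonempty) :
    x * J.card ≤ ((∑ e : T with ↑e ∈ (TwoComplex.Sub.ofFaces Y (J : Set F)).edges,
      (n e - c) : ℕ) : ℝ) := by
  have := Fintype.ofFinite E
  have := Fintype.ofFinite F
  set Z := TwoComplex.Sub.ofFaces Y (J : Set F)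
  have hfaces : (Z.faces.ncard : ℝ) = 2 * J.card := by
    have hdouble := sum_eq_two_mul_sum_transversal Y.finv_finv hA (s := Z.faces.toFinset)
      (fun f hf => Set.mem_toFinset.2 (Z.finv_mem f (Set.mem_toFinset.1 hf)))
      (g := fun _ => (1 : ℝ)) fun _ => rfl
    have hJ : (Z.faces.toFinset.filter fun f => f ∈ A) = J := by
      ext f
      rw [Finset.mem_filter, Set.mem_toFinset]
      refine ⟨fun ⟨hf, hfA⟩ => hf.resolve_right fun h => (hA f).1 (hJA h) hfA,
        fun hf => ⟨Or.inl hf, hJA hf⟩⟩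
    rwa [hJ, Finset.sum_const, Finset.sum_const, nsmul_one, nsmul_one,
      ← Set.ncard_eq_toFinset_card'] at hdouble
  have hedges : ∑ᶠ e ∈ Z.edges, ((n e : ℝ) - c) =
      2 * ((∑ e : T with ↑e ∈ Z.edges, (n e - c) : ℕ) : ℝ) := by
    rw [finsum_mem_eq_toFinset_sum, sum_eq_two_mul_sum_transversal Y.inv_inv hT
      (fun e he => Set.mem_toFinset.2 (Z.inv_mem e (Set.mem_toFinset.1 he)))
      fun e => by rw [hinv], Nat.cast_sum, Finset.sum_filter _ fun e : T => ((n e - c : ℕ) : ℝ),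
      Finset.sum_coe_sort T fun e => if e ∈ Z.edges then ((n e - c : ℕ) : ℝ) else 0,
      ← Finset.sum_filter]
    congr 1
    refine Finset.sum_congr ?_ fun e _ => (Nat.cast_sub (hc e)).symm
    ext e
    rw [Finset.mem_filter, Finset.mem_filter, Set.mem_toFinset, and_comm]
  obtain ⟨f, hf⟩ := hJ
  have := hx Z ⟨f, Or.inl hf⟩
  rw [hfaces, hedges] at this
  linarith

theorem subsetProb_not_fillable_subdivide_le [Fintype E] [Fintype F]
    {hinv : ∀ e, n (Y.inv e) = n e} {hn : ∀ e, 0 < n e} (hm : 2 ≤ m) [Fintype (relBall m ℓ)]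
    (hnE : ∀ e, 2 * Fintype.card E + 3 ≤ n e)
    (hfill : Fillable (Y.subdivide n hinv hn) (relBall m ℓ)) {x : ℝ}
    (hx : ∀ Z : Y.Sub, Z.faces.Nonempty → x * Z.faces.ncard ≤
      ∑ᶠ e ∈ Z.edges, ((n e : ℝ) - (2 * Fintype.card E + 3 : ℕ)))
    (hr : r ≤ Fintype.card (relBall m ℓ)) (hFr : 2 * Fintype.card F ≤ r) (hr0 : 0 < r)
    (hz : (Fintype.card (relBall m ℓ) / r : ℝ) * ((2 * m - 1 : ℕ) : ℝ) ^ (-x) ≤ 1) :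
    subsetProb r (fun S : Finset (relBall m ℓ) =>
      ¬ Fillable (Y.subdivide n hinv hn) (relators (S : Set (relBall m ℓ)))) ≤
      4 ^ Fintype.card F * (Nat.card (Finset F × (F → F)) *
        ((Fintype.card (relBall m ℓ) / r : ℝ) * ((2 * m - 1 : ℕ) : ℝ) ^ (-x))) := by
  classical
  obtain ⟨T, hT⟩ := exists_transversal Y.inv_inv Y.inv_ne
  obtain ⟨A, hA⟩ := exists_transversal Y.finv_finv Y.finv_ne
  obtain ⟨lab, lab_injective, fillable_of_lab, digits_eq⟩ := exists_label_family hm hnE hfill hA hT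
  set y : ℝ := Fintype.card (relBall m ℓ) / r
  set z : ℝ := y * ((2 * m - 1 : ℕ) : ℝ) ^ (-x)
  have : Nonempty (Fin (2 * m - 1)) := ⟨⟨0, by omega⟩⟩
  have hAF : A.card ≤ Fintype.card F := Finset.card_le_univ _
  have : 0 ≤ z := by positivity
  have hagree : ∀ J ⊆ A, J.Nonempty → ∀ ρ : F → relBall m ℓ,
      ((Finset.univ.filter fun t => ∀ g ∈ J, lab t g = ρ g).card : ℝ) * y ^ J.card ≤
        z * Fintype.card ((e : T) → Fin (n e - (2 * Fintype.card E + 3)) → Fin (2 * m - 1)) := by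
    intro J hJA hJ ρ
    refine mul_pow_le_of_mul_pow_le (Nat.cast_nonneg _) (by positivity)
      (by exact_mod_cast (by omega)) ?_ (mul_card_le_sum_transversal hinv hnE hx hA hT hJA hJ) hz
      hJ.card_pos.ne'
    refine mod_cast card_mul_pow_le_of_agree fun t ht t' ht' e he => ?_
    obtain ⟨f, hf, hef⟩ := (Finset.mem_filter.1 he).2
    exact digits_eq t t' f (((Finset.mem_filter.1 ht).2 f hf).trans
      ((Finset.mem_filter.1 ht').2 f hf).symm) e hef
  calc _ ≤ subsetProb r fun S => ∀ t, ¬ A.image (lab t) ⊆ S := by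
        refine subsetProb_mono fun S hS t ht => hS (fillable_of_lab t _ fun f hf => ?_)
        exact ⟨lab t f, ht (Finset.mem_image_of_mem _ hf), rfl⟩
    _ ≤ 4 ^ A.card * (Nat.card (Finset F × (F → F)) * z) := by
        refine subsetProb_forall_not_superset_le
          (fun t => Finset.card_image_of_injective _ (lab_injective t)) hr (by omega) hr0
          fun t => ?_
        refine (sum_pow_card_inter_image_le lab_injective (by positivity) (by positivity) hagree
          t).trans_eq (by ring)
    _ ≤ _ := by gcongr; norm_num

end LowerBound

/-! ### Subdivisions of geometric forms -/

section Subdivide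

variable {V E F : Type*} {Y : TwoComplex V E F} {n : E → ℕ}

/-- The subdivision of a sub-2-complex, as a sub-2-complex of the subdivision. -/
def TwoComplex.Sub.subdivide (Z : Y.Sub) (hinv : ∀ e, n (Y.inv e) = n e) (hn : ∀ e, 0 < n e) :
    (Y.subdivide n hinv hn).Sub where
  verts := {x | (∃ v ∈ Z.verts, x.1 = Sum.inl v) ∨ ∃ e ∈ Z.edges, ∃ i ≤ n e, x.1 = Y.point n e i}
  edges := {p | p.1.1 ∈ Z.edges}
  faces := Z.faces
  src_mem := fun p hp => Or.inr ⟨p.1.1, hp, p.1.2, p.2.le, rfl⟩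
  tgt_mem := fun p hp => Or.inr ⟨p.1.1, hp, p.1.2 + 1, p.2, rfl⟩
  inv_mem := fun p hp => Z.inv_mem p.1.1 hp
  finv_mem := Z.finv_mem
  bdry_mem := by
    intro f hf p hp
    obtain ⟨e, he, hpe⟩ := List.mem_flatMap.1 hp
    obtain ⟨i, -, rfl⟩ := List.mem_map.1 hpe
    exact Z.bdry_mem f hf e he

/-- A unit edge of the subdivision is an edge of `Y` together with a position on its arc. -/
def subdivEdgeEquiv (n : E → ℕ) : (Σ e, Fin (n e)) ≃ TwoComplex.SubdivEdge n where
  toFun p := ⟨(p.1, p.2), p.2.2⟩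
  invFun p := ⟨p.1.1, p.1.2, p.2⟩
  left_inv _ := rfl
  right_inv _ := rfl

theorem finite_subdivEdge [Finite E] (n : E → ℕ) : Finite (TwoComplex.SubdivEdge n) :=
  Finite.of_equiv _ (subdivEdgeEquiv n)

theorem ncard_edges_subdivide [Finite E] (Z : Y.Sub) (hinv : ∀ e, n (Y.inv e) = n e)
    (hn : ∀ e, 0 < n e) : (Z.subdivide hinv hn).edges.ncard = ∑ᶠ e ∈ Z.edges, n e := by
  classical
  have := Fintype.ofFinite E
  have himage : (Z.subdivide hinv hn).edges = subdivEdgeEquiv n ''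
      (Z.edges.toFinset.sigma fun _ => Finset.univ : Finset (Σ e, Fin (n e))) := by
    rw [Equiv.image_eq_preimage_symm]
    ext p
    simp [TwoComplex.Sub.subdivide, subdivEdgeEquiv]
  rw [himage, Set.ncard_image_of_injective _ (subdivEdgeEquiv n).injective, Set.ncard_coe_finset,
    Finset.card_sigma, finsum_mem_eq_toFinset_sum]
  simp only [Finset.card_univ, Fintype.card_fin]

end Subdivide

theorem sum_toFinset_le_sum_map {α : Type*} [DecidableEq α] {g : α → ℝ} (hg : ∀ a, 0 ≤ g a)
    (l : List α) : ∑ a ∈ l.toFinset, g a ≤ (l.map g).sum := by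
  rw [Finset.sum_list_map_count]
  refine Finset.sum_le_sum fun a ha => le_of_eq_of_le (one_nsmul _).symm ?_
  exact nsmul_le_nsmul_left (hg a) (List.one_le_count_iff.2 (List.mem_toFinset.1 ha))

namespace GeometricForm

variable {V E F : Type*} (Y : GeometricForm V E F)

theorem densC_nonneg : 0 ≤ Y.densC :=
  Real.iInf_nonneg fun _ => div_nonneg
    (div_nonneg (finsum_nonneg fun e => finsum_nonneg fun _ => (Y.len_pos e).le) zero_le_two)
    (by positivity)

theorem ncard_faces_pos {Z : Y.toTwoComplex.Sub} (hZ : Z.faces.Nonempty) :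
    (0 : ℝ) < Z.faces.ncard := by
  have := Y.finite_faces
  exact_mod_cast (Set.ncard_pos (Set.toFinite _)).2 hZ

theorem dens_mul_ncard {Z : Y.toTwoComplex.Sub} (hZ : Z.faces.Nonempty) :
    Y.dens Z * Z.faces.ncard = ∑ᶠ e ∈ Z.edges, Y.len e := by
  have := Y.ncard_faces_pos hZ
  rw [dens]
  field_simp

theorem densC_le_one : Y.densC ≤ 1 := by
  classical
  have := Y.finite_edges
  have := Y.finite_faces
  have := Fintype.ofFinite E
  have := Fintype.ofFinite F
  choose face hface using Y.noIsolatedEdges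
  have htotal : ∑ e, Y.len e ≤ Fintype.card F :=
    calc ∑ e, Y.len e = ∑ f, ∑ e with face e = f, Y.len e := (Finset.sum_fiberwise _ _ _).symm
      _ ≤ ∑ f, ∑ e ∈ (Y.bdry f).toFinset, Y.len e := by
        refine Finset.sum_le_sum fun f _ => Finset.sum_le_sum_of_subset_of_nonneg (fun e he => ?_)
          fun e _ _ => (Y.len_pos e).le
        exact List.mem_toFinset.2 ((Finset.mem_filter.1 he).2 ▸ hface e)
      _ ≤ ∑ _f : F, 1 := Finset.sum_le_sum fun f _ =>
        (sum_toFinset_le_sum_map (fun e => (Y.len_pos e).le) _).trans (Y.bdry_len_le f)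
      _ = Fintype.card F := by simp
  have hne : (TwoComplex.Sub.top Y.toTwoComplex).faces.Nonempty :=
    Y.nonempty_faces.elim fun f => ⟨f, Set.mem_univ f⟩
  refine (Y.densC_le _ hne).trans (le_of_mul_le_mul_right ?_ (Y.ncard_faces_pos hne))
  rw [Y.dens_mul_ncard hne, one_mul]
  simpa [TwoComplex.Sub.top, finsum_mem_univ, finsum_eq_sum_of_fintype] using htotal

theorem le_numEdges_add_one (ℓ : ℕ) (e : E) : Y.len e * ℓ ≤ Y.numEdges ℓ e + 1 := by
  have hfloor := (Nat.lt_floor_add_one (Y.len e * ℓ)).le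
  have : (⌊Y.len e * ℓ⌋₊ : ℝ) ≤ Y.numEdges ℓ e := by exact_mod_cast le_max_right _ _
  linarith

theorem numEdges_le_add_one (ℓ : ℕ) (e : E) : (Y.numEdges ℓ e : ℝ) ≤ Y.len e * ℓ + 1 := by
  have hpos : 0 ≤ Y.len e * ℓ := mul_nonneg (Y.len_pos e).le (Nat.cast_nonneg ℓ)
  rw [numEdges, Nat.cast_max, Nat.cast_one]
  exact max_le (by linarith) ((Nat.floor_le hpos).trans (by linarith))

theorem eventually_le_numEdges (c : ℕ) : ∀ᶠ ℓ in atTop, ∀ e, c ≤ Y.numEdges ℓ e := by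
  have := Y.finite_edges
  rw [eventually_all]
  intro e
  filter_upwards [(tendsto_natCast_atTop_atTop.const_mul_atTop
    (Y.len_pos e)).eventually_ge_atTop (c : ℝ)] with ℓ hℓ
  exact (Nat.le_floor hℓ).trans (le_max_right _ _)

variable {Y} {Z : Y.toTwoComplex.Sub}

theorem finsum_len_mul_add (hZ : Z.faces.Nonempty) (a b : ℝ) :
    ∑ᶠ e ∈ Z.edges, (Y.len e * a + b) = a * Y.dens Z * Z.faces.ncard + Z.edges.ncard * b := by
  classical
  have := Y.finite_edges
  have := Fintype.ofFinite E
  rw [mul_assoc, Y.dens_mul_ncard hZ, finsum_mem_eq_toFinset_sum, finsum_mem_eq_toFinset_sum,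
    Finset.sum_add_distrib, ← Finset.sum_mul, mul_comm, Finset.sum_const, nsmul_eq_mul,
    Set.ncard_eq_toFinset_card']

theorem ncard_edges_le_mul_ncard_faces (hZ : Z.faces.Nonempty) :
    (Z.edges.ncard : ℝ) ≤ Nat.card E * Z.faces.ncard := by
  have := Y.finite_edges
  have hfaces : 0 < Z.faces.ncard := by exact_mod_cast Y.ncard_faces_pos hZ
  exact_mod_cast (Set.ncard_le_card _).trans (Nat.le_mul_of_pos_right _ hfaces)

theorem finsum_numEdges_le (hZ : Z.faces.Nonempty) (ℓ : ℕ) :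
    ((∑ᶠ e ∈ Z.edges, Y.numEdges ℓ e : ℕ) : ℝ) ≤
      (ℓ * Y.dens Z + Nat.card E) * Z.faces.ncard := by
  classical
  have := Y.finite_edges
  have := Fintype.ofFinite E
  calc ((∑ᶠ e ∈ Z.edges, Y.numEdges ℓ e : ℕ) : ℝ) ≤ ∑ᶠ e ∈ Z.edges, (Y.len e * ℓ + 1) := by
        rw [finsum_mem_eq_toFinset_sum, finsum_mem_eq_toFinset_sum, Nat.cast_sum]
        exact Finset.sum_le_sum fun e _ => Y.numEdges_le_add_one ℓ e
    _ ≤ _ := by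
        rw [finsum_len_mul_add hZ]
        linarith [ncard_edges_le_mul_ncard_faces hZ]

theorem le_finsum_numEdges_sub (hZ : Z.faces.Nonempty) (ℓ c : ℕ) :
    (ℓ * Y.densC - Nat.card E * (c + 1)) * Z.faces.ncard ≤
      ∑ᶠ e ∈ Z.edges, ((Y.numEdges ℓ e : ℝ) - c) := by
  classical
  have := Y.finite_edges
  have := Fintype.ofFinite E
  have hedges := mul_le_mul_of_nonneg_right (ncard_edges_le_mul_ncard_faces hZ)
    (by positivity : (0 : ℝ) ≤ c + 1)
  have hdens : ℓ * Y.densC * Z.faces.ncard ≤ ℓ * Y.dens Z * Z.faces.ncard := by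
    gcongr
    exact Y.densC_le Z hZ
  calc _ ≤ ∑ᶠ e ∈ Z.edges, (Y.len e * ℓ + -(c + 1)) := by
        rw [finsum_len_mul_add hZ]
        linarith
    _ ≤ _ := by
        rw [finsum_mem_eq_toFinset_sum, finsum_mem_eq_toFinset_sum]
        exact Finset.sum_le_sum fun e _ => by linarith [Y.le_numEdges_add_one ℓ e]

end GeometricForm

/-! ### The phase transition -/

section Density

variable {α : Type*} [Finite α] {S : Set α} {d : ℝ}

theorem ncard_le_rpow_of_setDens_lt (hα : 1 < Nat.card α) (h : setDens S < (d : EReal)) :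
    (S.ncard : ℝ) ≤ (Nat.card α : ℝ) ^ d := by
  rcases S.eq_empty_or_nonempty with rfl | hS
  · rw [Set.ncard_empty, Nat.cast_zero]
    positivity
  · rw [setDens, if_neg hS.ne_empty, EReal.coe_lt_coe_iff,
      Real.logb_lt_iff_lt_rpow (by exact_mod_cast hα) (by exact_mod_cast hS.ncard_pos)] at h
    exact h.le

theorem rpow_le_ncard_of_lt_setDens (hα : 1 < Nat.card α) (h : (d : EReal) < setDens S) :
    (Nat.card α : ℝ) ^ d ≤ S.ncard := by
  rcases S.eq_empty_or_nonempty with rfl | hS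
  · simp [setDens] at h
  · rw [setDens, if_neg hS.ne_empty, EReal.coe_lt_coe_iff,
      Real.lt_logb_iff_rpow_lt (by exact_mod_cast hα) (by exact_mod_cast hS.ncard_pos)] at h
    exact h.le

end Density

theorem asymptoticallyAlmostSurely_of_measureReal_le {Ω : ℕ → Type*} [∀ ℓ, MeasurableSpace (Ω ℓ)]
    {P : ∀ ℓ, Measure (Ω ℓ)} [∀ ℓ, IsProbabilityMeasure (P ℓ)] {U Q : ∀ ℓ, Ω ℓ → Prop}
    (hU : AsymptoticallyAlmostSurely P U) {ε : ℕ → ℝ} (hε : Tendsto ε atTop (𝓝 0))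
    (h : ∀ᶠ ℓ in atTop, (P ℓ).real {ω | U ℓ ω ∧ ¬ Q ℓ ω} ≤ ε ℓ) :
    AsymptoticallyAlmostSurely P Q := by
  have hlower : Tendsto (fun ℓ => P ℓ {ω | U ℓ ω} - ENNReal.ofReal (ε ℓ)) atTop (𝓝 1) := by
    simpa using ENNReal.Tendsto.sub hU (ENNReal.tendsto_ofReal hε) (Or.inl ENNReal.one_ne_top)
  refine tendsto_of_tendsto_of_tendsto_of_le_of_le' hlower tendsto_const_nhds ?_
    (Eventually.of_forall fun ℓ => prob_le_one)
  filter_upwards [h] with ℓ hℓ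
  have hsub : {ω | U ℓ ω} ⊆ {ω | Q ℓ ω} ∪ {ω | U ℓ ω ∧ ¬ Q ℓ ω} := fun ω hω =>
    (em (Q ℓ ω)).imp_right fun hQ => ⟨hω, hQ⟩
  calc P ℓ {ω | U ℓ ω} - ENNReal.ofReal (ε ℓ)
      ≤ P ℓ {ω | U ℓ ω} - P ℓ {ω | U ℓ ω ∧ ¬ Q ℓ ω} := by
        gcongr
        rw [← ofReal_measureReal]
        exact ENNReal.ofReal_le_ofReal hℓ
    _ ≤ P ℓ {ω | Q ℓ ω} :=
        tsub_le_iff_right.2 ((measure_mono hsub).trans (measure_union_le _ _))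

section Asymptotics

variable {m : ℕ}

theorem tendsto_card_relBall_atTop (hm : 2 ≤ m) :
    Tendsto (fun ℓ => (Nat.card (relBall m ℓ) : ℝ)) atTop atTop := by
  have hpow : Tendsto (fun k : ℕ => ((2 * m - 1 : ℕ) : ℝ) ^ k) atTop atTop :=
    tendsto_pow_atTop_atTop_of_one_lt (by exact_mod_cast (by omega))
  exact (tendsto_add_atTop_iff_nat 2).1
    (tendsto_atTop_mono (fun k => by exact_mod_cast pow_le_card_relBall hm k) hpow)

theorem tendsto_rpow_mul_card_relBall_rpow (hm : 2 ≤ m) {δ d : ℝ} (hd : d ≤ 1)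
    (hδ : d < 1 - δ) (C : ℝ) :
    Tendsto (fun ℓ : ℕ => ((2 * m - 1 : ℕ) : ℝ) ^ (ℓ * δ + C) *
      (Nat.card (relBall m ℓ) : ℝ) ^ (d - 1)) atTop (𝓝 0) := by
  have hq : (1 : ℝ) < ((2 * m - 1 : ℕ) : ℝ) := by exact_mod_cast (by omega)
  have hball : ∀ k, ((2 * m - 1 : ℕ) : ℝ) ^ k ≤ Nat.card (relBall m (k + 2)) := fun k => by
    exact_mod_cast pow_le_card_relBall hm k
  set q : ℝ := ((2 * m - 1 : ℕ) : ℝ)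
  have hq0 : 0 < q := by linarith
  have hgeom : Tendsto (fun k : ℕ => q ^ (2 * δ + C) * (q ^ (δ + (d - 1))) ^ k) atTop (𝓝 0) := by
    simpa using (tendsto_pow_atTop_nhds_zero_of_lt_one (by positivity)
      (Real.rpow_lt_one_of_one_lt_of_neg hq (by linarith))).const_mul (q ^ (2 * δ + C))
  refine (tendsto_add_atTop_iff_nat 2).1 (squeeze_zero (fun k => by positivity) (fun k => ?_) hgeom)
  calc _ ≤ q ^ (((k + 2 : ℕ) : ℝ) * δ + C) * (q ^ k) ^ (d - 1) := by
        gcongr ?_ * ?_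
        exact Real.rpow_le_rpow_of_nonpos (by positivity) (hball k) (by linarith)
    _ = _ := by
        rw [← Real.rpow_natCast, ← Real.rpow_natCast, ← Real.rpow_mul hq0.le,
          ← Real.rpow_mul hq0.le, ← Real.rpow_add hq0, ← Real.rpow_add hq0]
        congr 1
        push_cast
        ring

theorem tendsto_card_relBall_rpow_mul_rpow (hm : 2 ≤ m) {δ d : ℝ} (hd0 : 0 ≤ d) (hd1 : d ≤ 1)
    (hδ : 1 - δ < d) (C : ℝ) :
    Tendsto (fun ℓ : ℕ => (Nat.card (relBall m ℓ) : ℝ) ^ (1 - d) *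
      ((2 * m - 1 : ℕ) : ℝ) ^ (-(ℓ * δ - C))) atTop (𝓝 0) := by
  have : NeZero m := ⟨by omega⟩
  have hq : (1 : ℝ) < ((2 * m - 1 : ℕ) : ℝ) := by exact_mod_cast (by omega)
  have hball : ∀ ℓ, (Nat.card (relBall m ℓ) : ℝ) ≤
      (ℓ + 1) * (2 * m) * ((2 * m - 1 : ℕ) : ℝ) ^ ℓ := fun ℓ => by
    rw [mul_assoc]
    exact_mod_cast card_relBall_le ℓ
  set q : ℝ := ((2 * m - 1 : ℕ) : ℝ)
  have hq0 : 0 < q := by linarith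
  set b : ℝ := q ^ (1 - d - δ) with hb
  have hb0 : 0 ≤ b := by positivity
  have hb1 : b < 1 := Real.rpow_lt_one_of_one_lt_of_neg hq (by linarith)
  have hgeom : Tendsto (fun ℓ : ℕ => 2 * m * q ^ C * (ℓ * b ^ ℓ + b ^ ℓ)) atTop (𝓝 0) := by
    simpa using ((tendsto_self_mul_const_pow_of_lt_one hb0 hb1).add
      (tendsto_pow_atTop_nhds_zero_of_lt_one hb0 hb1)).const_mul (2 * m * q ^ C)
  refine squeeze_zero (fun ℓ => by positivity) (fun ℓ => ?_) hgeom
  have hm1 : (1 : ℝ) ≤ m := by exact_mod_cast (by omega)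
  have hpoly : (1 : ℝ) ≤ (ℓ + 1) * (2 * m) := by nlinarith [Nat.cast_nonneg (α := ℝ) ℓ]
  calc _ ≤ ((ℓ + 1) * (2 * m) * q ^ ℓ) ^ (1 - d) * q ^ (-(ℓ * δ - C)) := by
        have := Real.rpow_le_rpow (Nat.cast_nonneg _) (hball ℓ) (sub_nonneg.2 hd1)
        gcongr
    _ = ((ℓ + 1) * (2 * m)) ^ (1 - d) * (q ^ C * b ^ ℓ) := by
        rw [Real.mul_rpow (by positivity) (by positivity), mul_assoc, hb, ← Real.rpow_natCast q,
          ← Real.rpow_natCast (q ^ _), ← Real.rpow_mul hq0.le, ← Real.rpow_mul hq0.le,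
          ← Real.rpow_add hq0, ← Real.rpow_add hq0]
        congr 2
        ring
    _ ≤ (ℓ + 1) * (2 * m) * (q ^ C * b ^ ℓ) := by
        gcongr
        exact (Real.rpow_le_rpow_of_exponent_le hpoly (by linarith)).trans_eq (Real.rpow_one _)
    _ = _ := by ring

end Asymptotics

section PhaseTransition

variable {m ℓ r : ℕ} [Fintype (relBall m ℓ)] {V E F : Type*} [Fintype F]
  (Y : GeometricForm V E F) {d : ℝ}

theorem GeometricForm.subsetProb_fillable_complex_le [NeZero m]
    (hB : 0 < Nat.card (relBall m ℓ)) (hr : r ≤ Fintype.card (relBall m ℓ))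
    (hrd : (r : ℝ) ≤ (Nat.card (relBall m ℓ) : ℝ) ^ d) {z : ℝ}
    (hz : 2 * m * (((2 * m - 1 : ℕ) : ℝ) ^ (ℓ * Y.densC + Nat.card E) *
      (Nat.card (relBall m ℓ) : ℝ) ^ (d - 1)) ≤ z) (hz1 : z ≤ 1) :
    subsetProb r (fun S : Finset (relBall m ℓ) =>
      Fillable (Y.complex ℓ) (relators (S : Set (relBall m ℓ)))) ≤
      Nat.card (Finset F × (F → FiberRank F)) * z := by
  have := Y.finite_edges
  have := finite_subdivEdge (Y.numEdges ℓ)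
  obtain ⟨Z, hZ, hZd⟩ := Y.exists_dens_eq_densC
  have hrz : 2 * m * ((2 * m - 1 : ℕ) : ℝ) ^ (ℓ * Y.densC + Nat.card E) *
      (r / Fintype.card (relBall m ℓ)) ≤ z := by
    refine le_trans ?_ hz
    rw [mul_assoc, ← Nat.card_eq_fintype_card, Real.rpow_sub_one (by positivity)]
    gcongr
  have hfree := finsum_numEdges_le hZ ℓ
  rw [hZd] at hfree
  refine (subsetProb_fillable_le (Z := Z.subdivide _ _) (Set.toFinite _) hZ
    (le_of_eq_of_le (congrArg _ (ncard_edges_subdivide Z _ _)) hfree) hr (hrz.trans hz1)).trans ?_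
  gcongr

theorem GeometricForm.subsetProb_not_fillable_complex_le [Fintype E] (hm : 2 ≤ m)
    (hn : ∀ e, 2 * Fintype.card E + 3 ≤ Y.numEdges ℓ e)
    (hfill : Fillable (Y.complex ℓ) (relBall m ℓ)) (hr : r ≤ Fintype.card (relBall m ℓ))
    (hr0 : 0 < r) (hFr : 2 * Fintype.card F ≤ r)
    (hrd : (Nat.card (relBall m ℓ) : ℝ) ^ d ≤ r) {z : ℝ}
    (hz : (Nat.card (relBall m ℓ) : ℝ) ^ (1 - d) * ((2 * m - 1 : ℕ) : ℝ) ^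
      (-(ℓ * Y.densC - Fintype.card E * (2 * Fintype.card E + 4))) ≤ z) (hz1 : z ≤ 1) :
    subsetProb r (fun S : Finset (relBall m ℓ) =>
      ¬ Fillable (Y.complex ℓ) (relators (S : Set (relBall m ℓ)))) ≤
      4 ^ Fintype.card F * (Nat.card (Finset F × (F → F)) * z) := by
  have hB : 0 < Nat.card (relBall m ℓ) := by
    rw [Nat.card_eq_fintype_card]
    omega
  have hrz : (Fintype.card (relBall m ℓ) / r : ℝ) * ((2 * m - 1 : ℕ) : ℝ) ^
      (-(ℓ * Y.densC - Fintype.card E * (2 * Fintype.card E + 4))) ≤ z := by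
    refine le_trans ?_ hz
    rw [← Nat.card_eq_fintype_card (α := relBall m ℓ), Real.rpow_sub (by positivity), Real.rpow_one]
    gcongr
  refine (subsetProb_not_fillable_subdivide_le hm hn hfill (fun Z hZ => ?_) hr hFr hr0
    (hrz.trans hz1)).trans (by gcongr)
  refine le_of_eq_of_le ?_ (le_finsum_numEdges_sub hZ ℓ (2 * Fintype.card E + 3))
  rw [Nat.card_eq_fintype_card]
  push_cast
  ring

end PhaseTransition

section RandomGroups

variable {m : ℕ} {d : EReal} {Ω : ℕ → Type*} [∀ ℓ, MeasurableSpace (Ω ℓ)]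
  {P : ∀ ℓ, Measure (Ω ℓ)} [∀ ℓ, IsProbabilityMeasure (P ℓ)]
  {R : ∀ ℓ, Ω ℓ → Set (relBall m ℓ)} {V E F : Type*} (Y : GeometricForm V E F)

theorem IsRandomGroupSeq.asymptoticallyAlmostSurely_of_subsetProb_le (hR : IsRandomGroupSeq P R d)
    {D : Set EReal} (hD : D ∈ 𝓝 d) {Q : ∀ ℓ, Set (relBall m ℓ) → Prop} {C : ℕ → ℕ → Prop}
    {ε : ℕ → ℝ} (hε : Tendsto ε atTop (𝓝 0))
    (hC : ∀ᶠ ℓ in atTop, ∀ S : Set (relBall m ℓ), setDens S ∈ D → C ℓ S.ncard)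
    (h : ∀ᶠ ℓ in atTop, 0 ≤ ε ℓ ∧ ∀ [Fintype (relBall m ℓ)], ∀ r ≤ Fintype.card (relBall m ℓ),
      C ℓ r → subsetProb r (fun S : Finset (relBall m ℓ) => ¬ Q ℓ S) ≤ ε ℓ) :
    AsymptoticallyAlmostSurely P fun ℓ ω => Q ℓ (R ℓ ω) := by
  refine asymptoticallyAlmostSurely_of_measureReal_le (hR.densable D hD) hε ?_
  filter_upwards [hC, h] with ℓ hC ⟨hε, h⟩
  have := (relBall_finite m ℓ).fintype
  have hbound := measureReal_le_of_subsetProb_le (P := P ℓ) (Q := fun S => ¬ Q ℓ S)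
    (hR.measurable ℓ) (hR.perm_invariant ℓ) hε h
  refine le_trans (measureReal_mono ?_) hbound
  exact fun ω hω => ⟨hC _ hω.1, hω.2⟩

theorem not_fillable_of_lt (hm : 2 ≤ m) (hR : IsRandomGroupSeq P R d)
    (hd : d < ((1 - Y.densC : ℝ) : EReal)) :
    AsymptoticallyAlmostSurely P fun ℓ ω => ¬ Fillable (Y.complex ℓ) (relators (R ℓ ω)) := by
  have : NeZero m := ⟨by omega⟩
  have := Y.finite_faces
  have := Fintype.ofFinite F
  obtain ⟨d', hdd', hd'⟩ := EReal.lt_iff_exists_real_btwn.1 hd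
  have hd' : d' < 1 - Y.densC := EReal.coe_lt_coe_iff.1 hd'
  let z : ℕ → ℝ := fun ℓ => 2 * m * (((2 * m - 1 : ℕ) : ℝ) ^ (ℓ * Y.densC + Nat.card E) *
    (Nat.card (relBall m ℓ) : ℝ) ^ (d' - 1))
  have hz : Tendsto z atTop (𝓝 0) := by
    rw [← mul_zero (2 * m : ℝ)]
    exact (tendsto_rpow_mul_card_relBall_rpow hm (by linarith [Y.densC_nonneg]) hd' _).const_mul _
  have hball := (tendsto_card_relBall_atTop hm).eventually_gt_atTop 1
  have hε : Tendsto (fun ℓ => Nat.card (Finset F × (F → FiberRank F)) * z ℓ) atTop (𝓝 0) := by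
    simpa only [mul_zero] using hz.const_mul _
  refine hR.asymptoticallyAlmostSurely_of_subsetProb_le
    (Q := fun ℓ S => ¬ Fillable (Y.complex ℓ) (relators S))
    (C := fun ℓ r => (r : ℝ) ≤ (Nat.card (relBall m ℓ) : ℝ) ^ d') (Iio_mem_nhds hdd') hε ?_ ?_
  · filter_upwards [hball] with ℓ hB S hS
    have := (relBall_finite m ℓ).to_subtype
    exact ncard_le_rpow_of_setDens_lt (by exact_mod_cast hB) hS
  · filter_upwards [hz.eventually_le_const one_pos, hball] with ℓ hz1 hB
    refine ⟨by positivity, fun r hr hrd => ?_⟩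
    simp only [not_not]
    exact Y.subsetProb_fillable_complex_le (by exact_mod_cast one_pos.trans hB) hr hrd le_rfl hz1

theorem fillable_of_gt (hm : 2 ≤ m) (hR : IsRandomGroupSeq P R d)
    (hd : ((1 - Y.densC : ℝ) : EReal) < d)
    (hfill : ∀ᶠ ℓ in atTop, Fillable (Y.complex ℓ) (relBall m ℓ)) :
    AsymptoticallyAlmostSurely P fun ℓ ω => Fillable (Y.complex ℓ) (relators (R ℓ ω)) := by
  have := Y.finite_edges
  have := Y.finite_faces
  have := Fintype.ofFinite E
  have := Fintype.ofFinite F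
  obtain ⟨d', hd', hdd'⟩ := EReal.lt_iff_exists_real_btwn.1 hd
  have hd' : 1 - Y.densC < d' := EReal.coe_lt_coe_iff.1 hd'
  have hd0 : 0 < d' := by linarith [Y.densC_le_one]
  have hd1 : d' ≤ 1 := by
    have : d ≤ 1 := hR.density_mem.elim (fun h => h ▸ bot_le) And.right
    exact_mod_cast (hdd'.trans_le this).le
  let z : ℕ → ℝ := fun ℓ => (Nat.card (relBall m ℓ) : ℝ) ^ (1 - d') * ((2 * m - 1 : ℕ) : ℝ) ^
    (-(ℓ * Y.densC - Fintype.card E * (2 * Fintype.card E + 4)))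
  have hz : Tendsto z atTop (𝓝 0) := tendsto_card_relBall_rpow_mul_rpow hm hd0.le hd1 hd' _
  have hball := tendsto_card_relBall_atTop hm
  have hε : Tendsto (fun ℓ => 4 ^ Fintype.card F * (Nat.card (Finset F × (F → F)) * z ℓ)) atTop
      (𝓝 0) := by
    simpa only [mul_zero] using (hz.const_mul _).const_mul _
  refine hR.asymptoticallyAlmostSurely_of_subsetProb_le
    (Q := fun ℓ S => Fillable (Y.complex ℓ) (relators S))
    (C := fun ℓ r => (Nat.card (relBall m ℓ) : ℝ) ^ d' ≤ r) (Ioi_mem_nhds hdd') hε ?_ ?_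
  · filter_upwards [hball.eventually_gt_atTop 1] with ℓ hB S hS
    have := (relBall_finite m ℓ).to_subtype
    exact rpow_le_ncard_of_lt_setDens (by exact_mod_cast hB) hS
  · filter_upwards [hz.eventually_le_const one_pos, hfill, Y.eventually_le_numEdges _,
      ((tendsto_rpow_atTop hd0).comp hball).eventually_ge_atTop
        (2 * Fintype.card F + 1 : ℝ)]
      with ℓ hz1 hfill hn hlarge
    refine ⟨by positivity, fun r hr hrd => ?_⟩
    have hFr : 2 * Fintype.card F + 1 ≤ r := by exact_mod_cast hlarge.trans hrd
    exact Y.subsetProb_not_fillable_complex_le hm hn hfill hr (by omega) (by omega) hrd le_rfl hz1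

end RandomGroups

theorem mainTheorem1 (m : ℕ) (hm : 2 ≤ m) (d : EReal)
    {Ω : ℕ → Type*} [∀ ℓ, MeasurableSpace (Ω ℓ)]
    (P : ∀ ℓ, Measure (Ω ℓ)) [∀ ℓ, IsProbabilityMeasure (P ℓ)]
    (R : ∀ ℓ, Ω ℓ → Set (relBall m ℓ)) (hR : IsRandomGroupSeq P R d)
    {V E F : Type*} (Y : GeometricForm V E F) :
    (d < ((1 - Y.densC : ℝ) : EReal) →
      AsymptoticallyAlmostSurely P
        (fun ℓ ω => ¬ Fillable (Y.complex ℓ) (relators (R ℓ ω)))) ∧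
    (((1 - Y.densC : ℝ) : EReal) < d →
      (∀ᶠ ℓ in atTop, Fillable (Y.complex ℓ) (relBall m ℓ)) →
      AsymptoticallyAlmostSurely P
        (fun ℓ ω => Fillable (Y.complex ℓ) (relators (R ℓ ω)))) :=
  ⟨not_fillable_of_lt Y hm hR, fillable_of_gt Y hm hR⟩
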